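/- Let $N\ge 1$ and $2<p_1\le p_2\le\dots\le p_N$ be real numbers, and put $q=\frac1N\sum_{i=1}^N p_i$. Let $g\in L^1_{loc}(\mathbb R^N)$ satisfy $g\ge c$ a.e. for some constant $c>0$. Assume that $p_i\,(N(q-1)+4)-N^2(q-1)>0$ for all $i=1,\dots,N$, and set $$A=\Big(\tfrac{N(q-1)(p_N-1)}{4},\infty\Big),\qquad I=\bigcap_{i=1}^N\Big(\tfrac{N^2(q-1)(p_i-1)}{p_i(N(q-1)+4)-N^2(q-1)},\infty\Big).$$ Let $1\le\delta=\gamma$ with $\delta\in A\cap I$, and let $f(t)=-(t^{-\delta}+t^{-\gamma})$ for $t>0$. Let $W^{1,p_i}_{loc}(\mathbb R^N)$ be the space of all $u\in W^{1,1}_{loc}(\mathbb R^N)$ whose weak derivatives satisfy $u_i:=\frac{\partial u}{\partial x_i}\in L^{p_i}_{loc}(\mathbb R^N)$ for $i=1,\dots,N$. Then no $u\in W^{1,p_i}_{loc}(\mathbb R^N)$ with $u>0$ a.e. in $\mathbb R^N$ is a stable solution of $$-\sum_{i=1}^N\frac{\partial}{\partial x_i}\Big(\Big|\frac{\partial u}{\partial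 x_i}\Big|^{p_i-2}\frac{\partial u}{\partial x_i}\Big)=g(x)f(u)\ \text{ in }\mathbb R^N,\qquad u>0\ \text{ in }\mathbb R^N.$$ Here a stable solution is a function $u\in W^{1,p_i}_{loc}(\mathbb R^N)$ with $u>0$ a.e. such that $g f(u),\,g f'(u)\in L^1_{loc}(\mathbb R^N)$ and, for all $\varphi\in C^1_c(\mathbb R^N)$, $$\sum_{i=1}^N\int_{\mathbb R^N}|u_i|^{p_i-2}u_i\,\frac{\partial\varphi}{\partial x_i}\,dx=\int_{\mathbb R^N}g f(u)\varphi\,dx$$ and $$\int_{\mathbb R^N}g f'(u)\varphi^2\,dx\le\sum_{i=1}^N(p_i-1)\int_{\mathbb R^N}|u_i|^{p_i-2}\Big|\frac{\partial\varphi}{\partial x_i}\Big|^2dx .$$ -/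

import Mathlib

open MeasureTheory

namespace AnisotropicStable

noncomputable section

/-- The classical partial derivative `∂φ/∂xᵢ` at `x`. -/
def partialDeriv {N : ℕ} (i : Fin N) (φ : EuclideanSpace ℝ (Fin N) → ℝ)
    (x : EuclideanSpace ℝ (Fin N)) : ℝ :=
  fderiv ℝ φ x (EuclideanSpace.single i 1)

/-- `v ∈ L¹_loc(ℝᴺ)` is the weak (distributional) partial derivative of `u` in the `i`-th
coordinate, tested against functions of class `C_c^∞(ℝᴺ)`. -/
def IsWeakPartial {N : ℕ} (i : Fin N) (u v : EuclideanSpace ℝ (Fin N) → ℝ) : Prop :=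
  LocallyIntegrable v volume ∧
    ∀ φ : EuclideanSpace ℝ (Fin N) → ℝ, ContDiff ℝ (⊤ : ℕ∞) φ → HasCompactSupport φ →
      ∫ x, u x * partialDeriv i φ x = -∫ x, v x * φ x

/-- `v ∈ L^r_loc(ℝᴺ)`, for a real exponent `r ≥ 1`. -/
def MemLpLoc {N : ℕ} (r : ℝ) (v : EuclideanSpace ℝ (Fin N) → ℝ) : Prop :=
  ∀ K : Set (EuclideanSpace ℝ (Fin N)), IsCompact K →
    MemLp v (ENNReal.ofReal r) (volume.restrict K)

/-- `Du = (∂u/∂x₁, …, ∂u/∂x_N)` in the weak sense, with `∂u/∂xᵢ ∈ L^{pᵢ}_loc(ℝᴺ)`.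
Such a `Du` is unique up to equality almost everywhere. -/
def IsWeakGradient {N : ℕ} (p : Fin N → ℝ) (u : EuclideanSpace ℝ (Fin N) → ℝ)
    (Du : Fin N → EuclideanSpace ℝ (Fin N) → ℝ) : Prop :=
  ∀ i, IsWeakPartial i u (Du i) ∧ MemLpLoc (p i) (Du i)

/-- `u ∈ W^{1,pᵢ}_loc(ℝᴺ)`: `u ∈ L¹_loc` has weak partial derivatives in `L¹_loc`,
the `i`-th of which is in `L^{pᵢ}_loc`. -/
def MemSobolevLoc {N : ℕ} (p : Fin N → ℝ) (u : EuclideanSpace ℝ (Fin N) → ℝ) : Prop :=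
  LocallyIntegrable u volume ∧ ∃ Du, IsWeakGradient p u Du

/-- `u` is a stable solution of
`-∑ᵢ ∂ᵢ(|∂ᵢu|^{pᵢ-2} ∂ᵢu) = g(x) f(u)` in `ℝᴺ`, `u > 0` in `ℝᴺ`. -/
structure IsStableSolution {N : ℕ} (p : Fin N → ℝ) (g : EuclideanSpace ℝ (Fin N) → ℝ)
    (f : ℝ → ℝ) (u : EuclideanSpace ℝ (Fin N) → ℝ) : Prop where
  memSobolevLoc : MemSobolevLoc p u
  pos : ∀ᵐ x, 0 < u x
  locInt : LocallyIntegrable (fun x => g x * f (u x)) volume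
  locInt_deriv : LocallyIntegrable (fun x => g x * deriv f (u x)) volume
  /-- The weak form of the equation, and the stability inequality. -/
  weak_and_stable : ∃ Du, IsWeakGradient p u Du ∧
    (∀ φ : EuclideanSpace ℝ (Fin N) → ℝ, ContDiff ℝ 1 φ → HasCompactSupport φ →
      ∑ i, ∫ x, |Du i x| ^ (p i - 2) * Du i x * partialDeriv i φ x
        = ∫ x, g x * f (u x) * φ x) ∧
    (∀ φ : EuclideanSpace ℝ (Fin N) → ℝ, ContDiff ℝ 1 φ → HasCompactSupport φ →
      ∫ x, g x * deriv f (u x) * φ x ^ 2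
        ≤ ∑ i, (p i - 1) * ∫ x, |Du i x| ^ (p i - 2) * |partialDeriv i φ x| ^ 2)

/-- `f(t) = -(t^{-δ} + t^{-γ})`, used for `t > 0`. -/
def singularF (δ γ : ℝ) (t : ℝ) : ℝ := -(t ^ (-δ) + t ^ (-γ))

/-- The arithmetic mean `q = (p₁ + ⋯ + p_N) / N`. -/
def meanExp {N : ℕ} (p : Fin N → ℝ) : ℝ := (∑ i, p i) / N

/-- `A = (N (q - 1) (p_N - 1) / 4, ∞)`; the index `N - 1` is the last one in `Fin N`. -/
def setA {N : ℕ} (hN : 1 ≤ N) (p : Fin N → ℝ) : Set ℝ :=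
  Set.Ioi (N * (meanExp p - 1) * (p ⟨N - 1, by omega⟩ - 1) / 4)

/-- The denominator `pᵢ (N (q - 1) + 4) - N² (q - 1)` in the definition of `Iᵢ`. -/
def denI {N : ℕ} (p : Fin N → ℝ) (i : Fin N) : ℝ :=
  p i * (N * (meanExp p - 1) + 4) - (N : ℝ) ^ 2 * (meanExp p - 1)

/-- `I = ⋂ᵢ Iᵢ` with `Iᵢ = (N² (q - 1) (pᵢ - 1) / (pᵢ (N (q - 1) + 4) - N² (q - 1)), ∞)`,
meaningful when all the denominators are positive. -/
def setI {N : ℕ} (p : Fin N → ℝ) : Set ℝ :=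
  ⋂ i, Set.Ioi ((N : ℝ) ^ 2 * (meanExp p - 1) * (p i - 1) / denI p i)

end

end AnisotropicStable

/-! Write `v = 1 + u` and let `χ` be a cutoff. The stability inequality is tested with `v ^ (-β) χ ^
m`, the equation with `v ^ (-(2β+1)) χ ^ (2m)`, and the two are combined with a weight `lam < δ` on
the equation. Since `u / (1 + u) ≤ 1`, the terms with `f` and `f'` leave at least `2 (δ - lam) c ∫ v
^ (-κ) χ ^ (2m)`, where `κ = δ + 1 + 2β` (`reaction_terms_lower_bound`).

On the gradient side `|uᵢ| ^ pᵢ v ^ (-2β-2) χ ^ (2m)` has coefficient `(pᵢ - 1) β² - lam (2β + 1)`.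
When this is negative it absorbs the cross terms (`exists_quadratic_lower_bound`). Young's
inequality (`exists_young_bound`) then moves the remaining powers of `v` to the left. What stays is
`∫ v ^ (-κ) χ ^ (2m) ≤ C ∑ᵢ ∫ |∂ᵢχ| ^ σᵢ` with `σᵢ = pᵢ κ / (pᵢ + δ - 1)`. For a cutoff at scale `R`
the right side is `O(∑ᵢ R ^ (N - σᵢ))`. If every `σᵢ > N` it tends to zero, while the left side
stays above the positive integral of `v ^ (-κ)` over the unit ball.

The choice `β = 2δ / ∑ⱼ (pⱼ - 1)` meets all requirements: the condition `A` gives `pᵢ < 2β + 1`, and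
`I` gives `σᵢ > N`.

The test functions are not `C¹`, so they are reached by mollifying `u` and passing to the limit. The
shift by 1 keeps the negative powers bounded, as `u` has no positive lower bound. -/

section Mollification

open Set Filter Topology Metric ContinuousLinearMap
open scoped Convolution ENNReal

namespace AnisotropicStable

variable {N : ℕ}

/-! ### Mollification of weakly differentiable functions. -/

/-- Young's inequality for the convolution with a normalized bump function, in the form
`∫ |ρ ⋆ f| ^ p ≤ ∫ |f| ^ p`. -/
theorem lintegral_normed_convolution_rpow_le (φ : ContDiffBump (0 : EuclideanSpace ℝ (Fin N)))
    {p : ℝ} (hp : 1 ≤ p) {f : EuclideanSpace ℝ (Fin N) → ℝ} (hf : AEStronglyMeasurable f volume) :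
    ∫⁻ x, ‖(φ.normed volume ⋆[lsmul ℝ ℝ, volume] f) x‖ₑ ^ p ≤ ∫⁻ x, ‖f x‖ₑ ^ p := by
  have hp0 : 0 < p := by linarith
  set ρ : EuclideanSpace ℝ (Fin N) → ℝ≥0∞ := fun t => ENNReal.ofReal (φ.normed volume t) with hρ
  have hρm : Measurable ρ := φ.continuous_normed.measurable.ennreal_ofReal
  have hρ1 : ∫⁻ t, ρ t = 1 := by
    rw [hρ, ← ofReal_integral_eq_lintegral_ofReal φ.integrable_normed
      (Eventually.of_forall φ.nonneg_normed), φ.integral_normed, ENNReal.ofReal_one]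
  -- Against the probability measure `ν`, Jensen's inequality is the monotonicity of `L ^ q` norms
  -- in `q`; Tonelli and translation invariance then finish.
  set ν := (volume : Measure (EuclideanSpace ℝ (Fin N))).withDensity ρ with hν
  have : IsProbabilityMeasure ν := ⟨by rw [hν, withDensity_apply _ .univ]; simpa using hρ1⟩
  have hfx (x : EuclideanSpace ℝ (Fin N)) :
      AEStronglyMeasurable (fun t => f (x - t)) volume :=
    hf.comp_quasiMeasurePreserving (quasiMeasurePreserving_sub_left volume x)
  have key (x : EuclideanSpace ℝ (Fin N)) :
      ‖(φ.normed volume ⋆[lsmul ℝ ℝ, volume] f) x‖ₑ ^ p ≤ ∫⁻ t, ρ t * ‖f (x - t)‖ₑ ^ p := by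
    have h1 : ‖(φ.normed volume ⋆[lsmul ℝ ℝ, volume] f) x‖ₑ ≤ ∫⁻ t, ‖f (x - t)‖ₑ ∂ν := by
      rw [hν, lintegral_withDensity_eq_lintegral_mul₀ hρm.aemeasurable (hfx x).enorm]
      refine (enorm_integral_le_lintegral_enorm _).trans (le_of_eq ?_)
      refine lintegral_congr fun t => ?_
      simp [hρ, Real.enorm_of_nonneg (φ.nonneg_normed t)]
    have h2 := eLpNorm'_le_eLpNorm'_of_exponent_le (μ := ν) one_pos hp
      ((hfx x).mono_ac (withDensity_absolutelyContinuous _ _))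
    simp only [eLpNorm', ENNReal.rpow_one, div_one] at h2
    calc _ ≤ ((∫⁻ t, ‖f (x - t)‖ₑ ^ p ∂ν) ^ (1 / p)) ^ p := by gcongr; exact h1.trans h2
      _ = ∫⁻ t, ‖f (x - t)‖ₑ ^ p ∂ν := by
        rw [← ENNReal.rpow_mul, one_div_mul_cancel hp0.ne', ENNReal.rpow_one]
      _ = _ := by
        rw [hν, lintegral_withDensity_eq_lintegral_mul₀ hρm.aemeasurable
          ((hfx x).enorm.pow_const p)]
        rfl
  have hjoint : AEMeasurable (fun z : EuclideanSpace ℝ (Fin N) × EuclideanSpace ℝ (Fin N) =>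
      ρ z.2 * ‖f (z.1 - z.2)‖ₑ ^ p) (volume.prod volume) := by
    refine (hρm.comp measurable_snd).aemeasurable.mul (AEMeasurable.pow_const ?_ p)
    exact (hf.comp_quasiMeasurePreserving (quasiMeasurePreserving_sub volume volume)).enorm
  calc _ ≤ ∫⁻ x, ∫⁻ t, ρ t * ‖f (x - t)‖ₑ ^ p := lintegral_mono key
    _ = ∫⁻ t, ∫⁻ x, ρ t * ‖f (x - t)‖ₑ ^ p := lintegral_lintegral_swap hjoint
    _ = ∫⁻ t, ρ t * ∫⁻ x, ‖f x‖ₑ ^ p := by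
      refine lintegral_congr fun t => ?_
      rw [lintegral_const_mul' _ _ (by simp [hρ]),
        lintegral_sub_right_eq_self (fun x => ‖f x‖ₑ ^ p) t]
    _ = _ := by rw [lintegral_mul_const _ hρm, hρ1, one_mul]

theorem eLpNorm_normed_convolution_le (φ : ContDiffBump (0 : EuclideanSpace ℝ (Fin N)))
    {p : ℝ} (hp : 1 ≤ p) {f : EuclideanSpace ℝ (Fin N) → ℝ} (hf : AEStronglyMeasurable f volume) :
    eLpNorm (φ.normed volume ⋆[lsmul ℝ ℝ, volume] f) (ENNReal.ofReal p) volume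
      ≤ eLpNorm f (ENNReal.ofReal p) volume := by
  have hp0 : 0 < p := by linarith
  rw [eLpNorm_eq_lintegral_rpow_enorm_toReal (by simpa using hp0) (by simp),
    eLpNorm_eq_lintegral_rpow_enorm_toReal (by simpa using hp0) (by simp),
    ENNReal.toReal_ofReal hp0.le]
  exact ENNReal.rpow_le_rpow (lintegral_normed_convolution_rpow_le φ hp hf) (by positivity)

/-- Mollifications of a continuous compactly supported function converge to it in `L ^ p`. -/
theorem exists_forall_eLpNorm_normed_convolution_sub_le_of_continuous {p : ℝ} (hp : 1 ≤ p)
    {h : EuclideanSpace ℝ (Fin N) → ℝ} (hc : Continuous h) (hs : HasCompactSupport h)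
    {ε : ℝ≥0∞} (hε : ε ≠ 0) :
    ∃ r > 0, ∀ φ : ContDiffBump (0 : EuclideanSpace ℝ (Fin N)), φ.rOut < r →
      eLpNorm (fun x => (φ.normed volume ⋆[lsmul ℝ ℝ, volume] h) x - h x)
        (ENNReal.ofReal p) volume ≤ ε := by
  have hp0 : 0 < p := by linarith
  -- For radii below 1 both `h` and its mollification vanish off `K`, so a uniform error `η` costs
  -- at most `η * volume K ^ (1 / p)` in `L ^ p`.
  set K := cthickening 1 (tsupport h) with hK
  have hKc : IsCompact K := hs.isCompact.cthickening
  have hfin : volume K ^ (1 / p) ≠ ∞ := by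
    exact ENNReal.rpow_ne_top_of_nonneg (by positivity) hKc.measure_lt_top.ne
  obtain ⟨η, hη0, hη⟩ : ∃ η : ℝ, 0 < η ∧ volume K ^ (1 / p) * ENNReal.ofReal η ≤ ε := by
    obtain ⟨d, hd0, hd⟩ := ENNReal.exists_nnreal_pos_mul_lt hfin hε
    exact ⟨d, by exact_mod_cast hd0, by simpa [mul_comm] using hd.le⟩
  obtain ⟨r, hr0, hr⟩ := Metric.uniformContinuous_iff.1
    (hs.uniformContinuous_of_continuous hc) η hη0
  refine ⟨min r 1, by positivity, fun φ hφ => ?_⟩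
  have hle (x : EuclideanSpace ℝ (Fin N)) :
      dist ((φ.normed volume ⋆[lsmul ℝ ℝ, volume] h) x) (h x) ≤ η := by
    refine φ.dist_normed_convolution_le hc.aestronglyMeasurable fun y hy => ?_
    exact (hr ((mem_ball.1 hy).trans (hφ.trans_le (min_le_left _ _)))).le
  have hzero (x : EuclideanSpace ℝ (Fin N)) (hx : x ∉ K) :
      (φ.normed volume ⋆[lsmul ℝ ℝ, volume] h) x - h x = 0 := by
    have hball : ∀ y ∈ ball x φ.rOut, h y = 0 := by
      intro y hy
      by_contra hne
      refine hx (mem_cthickening_of_dist_le x y 1 _ (subset_tsupport h hne) ?_)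
      rw [dist_comm]
      exact ((mem_ball.1 hy).trans (hφ.trans_le (min_le_right _ _))).le
    have hx0 := hball x (mem_ball_self φ.rOut_pos)
    rw [φ.normed_convolution_eq_right fun y hy => by rw [hball y hy, hx0], sub_self]
  have hind : (fun x => (φ.normed volume ⋆[lsmul ℝ ℝ, volume] h) x - h x)
      = K.indicator (fun x => (φ.normed volume ⋆[lsmul ℝ ℝ, volume] h) x - h x) := by
    ext x
    by_cases hx : x ∈ K
    · rw [indicator_of_mem hx]
    · rw [indicator_of_notMem hx, hzero x hx]
  rw [hind, eLpNorm_indicator_eq_eLpNorm_restrict hKc.measurableSet]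
  refine (eLpNorm_le_of_ae_bound (C := η) (Eventually.of_forall fun x => ?_)).trans ?_
  · rw [← dist_eq_norm]; exact hle x
  · rw [Measure.restrict_apply_univ, ENNReal.toReal_ofReal hp0.le, ← one_div]
    exact hη

/-- Mollifications of an `L ^ p` function converge to it in `L ^ p`. -/
theorem exists_forall_eLpNorm_normed_convolution_sub_le {p : ℝ} (hp : 1 ≤ p)
    {f : EuclideanSpace ℝ (Fin N) → ℝ} (hf : MemLp f (ENNReal.ofReal p) volume)
    {ε : ℝ≥0∞} (hε : ε ≠ 0) :
    ∃ r > 0, ∀ φ : ContDiffBump (0 : EuclideanSpace ℝ (Fin N)), φ.rOut < r →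
      eLpNorm (fun x => (φ.normed volume ⋆[lsmul ℝ ℝ, volume] f) x - f x)
        (ENNReal.ofReal p) volume ≤ ε := by
  have hε3 : ε / 3 ≠ 0 := by simpa using hε
  have hp1 : 1 ≤ ENNReal.ofReal p := by simpa using hp
  obtain ⟨h, hs, hfh, hc, hmem⟩ := hf.exists_hasCompactSupport_eLpNorm_sub_le (by simp) hε3
  obtain ⟨r, hr0, hr⟩ :=
    exists_forall_eLpNorm_normed_convolution_sub_le_of_continuous hp hc hs hε3
  refine ⟨r, hr0, fun φ hφ => ?_⟩
  have hloc : LocallyIntegrable (f - h) volume := (hf.sub hmem).locallyIntegrable hp1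
  have hloch : LocallyIntegrable h volume := hmem.locallyIntegrable hp1
  have hex (k : EuclideanSpace ℝ (Fin N) → ℝ) (hk : LocallyIntegrable k volume) :
      ConvolutionExists (φ.normed volume) k (lsmul ℝ ℝ) volume :=
    φ.hasCompactSupport_normed.convolutionExists_left _ φ.continuous_normed hk
  have hcont (k : EuclideanSpace ℝ (Fin N) → ℝ) (hk : LocallyIntegrable k volume) :
      Continuous (φ.normed volume ⋆[lsmul ℝ ℝ, volume] k) :=
    φ.hasCompactSupport_normed.continuous_convolution_left _ φ.continuous_normed hk
  have hdec : (fun x => (φ.normed volume ⋆[lsmul ℝ ℝ, volume] f) x - f x)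
      = ((φ.normed volume ⋆[lsmul ℝ ℝ, volume] (f - h))
        + fun x => (φ.normed volume ⋆[lsmul ℝ ℝ, volume] h) x - h x) + (h - f) := by
    have hadd := ConvolutionExists.distrib_add (hex _ hloc) (hex _ hloch)
    rw [sub_add_cancel] at hadd
    ext x
    rw [hadd]
    simp
    ring
  have hm1 := (hcont _ hloc).aestronglyMeasurable (μ := volume)
  have hm2 : AEStronglyMeasurable
      (fun x => (φ.normed volume ⋆[lsmul ℝ ℝ, volume] h) x - h x) volume :=
    ((hcont _ hloch).sub hc).aestronglyMeasurable
  rw [hdec]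
  refine (eLpNorm_add_le (hm1.add hm2) (hmem.sub hf).aestronglyMeasurable hp1).trans ?_
  refine (add_le_add_left (eLpNorm_add_le hm1 hm2 hp1) _).trans ?_
  calc _ ≤ ε / 3 + ε / 3 + ε / 3 := by
        refine add_le_add (add_le_add ?_ (hr φ hφ)) ?_
        · exact (eLpNorm_normed_convolution_le φ hp (hf.sub hmem).aestronglyMeasurable).trans hfh
        · rwa [← eLpNorm_neg, neg_sub]
    _ = ε := ENNReal.add_thirds ε

/-- Mollifications of an `L ^ p_loc` function converge to it in `L ^ p` on compact sets. -/
theorem exists_forall_lintegral_normed_convolution_sub_le {p : ℝ} (hp : 1 ≤ p)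
    {f : EuclideanSpace ℝ (Fin N) → ℝ} (hf : MemLpLoc p f)
    {K : Set (EuclideanSpace ℝ (Fin N))} (hK : IsCompact K) {ε : ℝ≥0∞} (hε : ε ≠ 0) :
    ∃ r > 0, ∀ φ : ContDiffBump (0 : EuclideanSpace ℝ (Fin N)), φ.rOut < r →
      ∫⁻ x in K, ‖(φ.normed volume ⋆[lsmul ℝ ℝ, volume] f) x - f x‖ₑ ^ p ≤ ε := by
  have hp0 : 0 < p := by linarith
  -- On `K`, mollification at radius below 1 sees only the values of `f` on `K'`, so `f` may be
  -- replaced by a truncation that is globally in `L ^ p`.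
  set K' := cthickening 1 K
  have hK' : IsCompact K' := hK.cthickening
  have hmem : MemLp (K'.indicator f) (ENNReal.ofReal p) volume :=
    (memLp_indicator_iff_restrict hK'.measurableSet).2 (hf K' hK')
  obtain ⟨η, hη0, hη⟩ : ∃ η : ℝ≥0∞, η ≠ 0 ∧ η ^ p ≤ ε :=
    ⟨ε ^ (1 / p), by simp [ENNReal.rpow_eq_zero_iff, hε, hp0.le], by
      rw [← ENNReal.rpow_mul, one_div_mul_cancel hp0.ne', ENNReal.rpow_one]⟩
  obtain ⟨r, hr0, hr⟩ := exists_forall_eLpNorm_normed_convolution_sub_le hp hmem hη0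
  refine ⟨min r 1, by positivity, fun φ hφ => ?_⟩
  have h1 := hr φ (hφ.trans_le (min_le_left _ _))
  rw [eLpNorm_eq_lintegral_rpow_enorm_toReal (by simpa using hp0) (by simp),
    ENNReal.toReal_ofReal hp0.le] at h1
  have hcongr (x : EuclideanSpace ℝ (Fin N)) (hx : x ∈ K) :
      (φ.normed volume ⋆[lsmul ℝ ℝ, volume] f) x - f x =
        (φ.normed volume ⋆[lsmul ℝ ℝ, volume] K'.indicator f) x - K'.indicator f x := by
    have hxK' : x ∈ K' := self_subset_cthickening K hx
    rw [indicator_of_mem hxK', sub_left_inj]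
    refine integral_congr_ae (Eventually.of_forall fun t => ?_)
    by_cases ht : t ∈ ball (0 : EuclideanSpace ℝ (Fin N)) φ.rOut
    · have : x - t ∈ K' := by
        refine mem_cthickening_of_dist_le _ x 1 _ hx ?_
        rw [dist_eq_norm, sub_sub_cancel_left, norm_neg]
        exact ((mem_ball_zero_iff.1 ht).trans (hφ.trans_le (min_le_right _ _))).le
      simp [indicator_of_mem this]
    · have : φ.normed volume t = 0 := by
        rw [← Function.notMem_support, φ.support_normed_eq]; exact ht
      simp [this]
  calc _ = ∫⁻ x in K, ‖(φ.normed volume ⋆[lsmul ℝ ℝ, volume] K'.indicator f) x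
            - K'.indicator f x‖ₑ ^ p :=
        setLIntegral_congr_fun hK.measurableSet fun x hx => by rw [hcongr x hx]
    _ ≤ ∫⁻ x, ‖(φ.normed volume ⋆[lsmul ℝ ℝ, volume] K'.indicator f) x
            - K'.indicator f x‖ₑ ^ p := setLIntegral_le_lintegral _ _
    _ = ((∫⁻ x, ‖(φ.normed volume ⋆[lsmul ℝ ℝ, volume] K'.indicator f) x
            - K'.indicator f x‖ₑ ^ p) ^ (1 / p)) ^ p := by
        rw [← ENNReal.rpow_mul, one_div_mul_cancel hp0.ne', ENNReal.rpow_one]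
    _ ≤ η ^ p := by gcongr
    _ ≤ ε := hη

/-- The classical derivative of a mollification is the mollification of the weak derivative. -/
theorem partialDeriv_normed_convolution {i : Fin N} {u v : EuclideanSpace ℝ (Fin N) → ℝ}
    (hu : LocallyIntegrable u volume) (huv : IsWeakPartial i u v)
    (φ : ContDiffBump (0 : EuclideanSpace ℝ (Fin N))) (x : EuclideanSpace ℝ (Fin N)) :
    partialDeriv i (φ.normed volume ⋆[lsmul ℝ ℝ, volume] u) x
      = (φ.normed volume ⋆[lsmul ℝ ℝ, volume] v) x := by
  have hsm : ContDiff ℝ (⊤ : ℕ∞) (φ.normed volume) := φ.contDiff_normed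
  have h1 : ContDiff ℝ 1 (φ.normed volume) := φ.contDiff_normed
  have hcs : HasCompactSupport (φ.normed volume) := φ.hasCompactSupport_normed
  have hdc : Continuous (fderiv ℝ (φ.normed volume)) := h1.continuous_fderiv one_ne_zero
  -- The sign produced by reflecting the kernel cancels the one in the definition of the weak
  -- derivative.
  set ψ : EuclideanSpace ℝ (Fin N) → ℝ := fun y => φ.normed volume (x - y) with hψ
  have hψs : ContDiff ℝ (⊤ : ℕ∞) ψ := hsm.comp (contDiff_const.sub contDiff_id)
  have hψc : HasCompactSupport ψ := hcs.comp_homeomorph (Homeomorph.subLeft x)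
  have hψd (y : EuclideanSpace ℝ (Fin N)) : partialDeriv i ψ y
      = -fderiv ℝ (φ.normed volume) (x - y) (EuclideanSpace.single i 1) := by
    have hd : HasFDerivAt ψ ((fderiv ℝ (φ.normed volume) (x - y)).comp
        (-ContinuousLinearMap.id ℝ _)) y :=
      (h1.differentiable one_ne_zero (x - y)).hasFDerivAt.comp y ((hasFDerivAt_id y).const_sub x)
    simp [partialDeriv, hd.fderiv]
  have hex : ConvolutionExistsAt (fderiv ℝ (φ.normed volume)) u x
      ((lsmul ℝ ℝ : ℝ →L[ℝ] ℝ →L[ℝ] ℝ).precompL _) volume :=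
    (hcs.fderiv ℝ).convolutionExists_left _ hdc hu x
  have hweak := huv.2 ψ hψs hψc
  rw [partialDeriv, (hcs.hasFDerivAt_convolution_left _ h1 hu x).fderiv]
  rw [convolution_def, ContinuousLinearMap.integral_apply hex]
  rw [convolution_eq_swap]
  simp only [hψd, mul_neg, integral_neg, neg_inj] at hweak
  calc _ = ∫ t, fderiv ℝ (φ.normed volume) (x - (x - t)) (EuclideanSpace.single i 1)
        * u (x - t) := by
        refine integral_congr_ae (Eventually.of_forall fun t => ?_)
        simp
    _ = ∫ t, fderiv ℝ (φ.normed volume) (x - t) (EuclideanSpace.single i 1) * u t :=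
        integral_sub_left_eq_self (fun t => fderiv ℝ (φ.normed volume) (x - t)
          (EuclideanSpace.single i 1) * u t) volume x
    _ = ∫ t, u t * fderiv ℝ (φ.normed volume) (x - t) (EuclideanSpace.single i 1) := by
        simp only [mul_comm]
    _ = _ := hweak
    _ = _ := by simp [hψ, mul_comm]

/-- A nonnegative function with a weak gradient is, on every compact set, the almost everywhere
limit of smooth nonnegative functions whose gradients converge almost everywhere with
integrable `p i`-th power domination. -/
theorem exists_smooth_approximation {p : Fin N → ℝ} (hp : ∀ i, 1 ≤ p i)
    {u : EuclideanSpace ℝ (Fin N) → ℝ} (hu : LocallyIntegrable u volume) (hpos : ∀ᵐ x, 0 < u x)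
    {Du : Fin N → EuclideanSpace ℝ (Fin N) → ℝ} (hDu : IsWeakGradient p u Du)
    {K : Set (EuclideanSpace ℝ (Fin N))} (hK : IsCompact K) :
    ∃ (w : ℕ → EuclideanSpace ℝ (Fin N) → ℝ) (S : Fin N → EuclideanSpace ℝ (Fin N) → ℝ),
      (∀ n, ContDiff ℝ 1 (w n)) ∧ (∀ n x, 0 ≤ w n x) ∧
      (∀ᵐ x, Tendsto (fun n => w n x) atTop (𝓝 (u x))) ∧
      (∀ i, ∀ᵐ x, Tendsto (fun n => partialDeriv i (w n) x) atTop (𝓝 (Du i x))) ∧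
      (∀ i, IntegrableOn (S i) K volume) ∧
      (∀ i, ∀ᵐ x ∂(volume.restrict K), ∀ n, |partialDeriv i (w n) x - Du i x| ^ p i ≤ S i x) := by
  have hchoice (n : ℕ) : ∃ r : ℝ, 0 < r ∧ r ≤ 1 / ((n : ℝ) + 1) ∧
      ∀ φ : ContDiffBump (0 : EuclideanSpace ℝ (Fin N)), φ.rOut < r → ∀ i,
      ∫⁻ x in K, ‖(φ.normed volume ⋆[lsmul ℝ ℝ, volume] Du i) x - Du i x‖ₑ ^ p i
        ≤ (2⁻¹ : ℝ≥0∞) ^ n := by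
    have := fun i => exists_forall_lintegral_normed_convolution_sub_le (hp i) (hDu i).2 hK
      (ε := (2⁻¹ : ℝ≥0∞) ^ n) (by simp)
    choose r hr0 hr using this
    obtain ⟨m, hm0, hm⟩ : ∃ m > 0, ∀ i, m ≤ r i := by
      rcases isEmpty_or_nonempty (Fin N) with h | h
      · exact ⟨1, one_pos, fun i => h.elim i⟩
      · obtain ⟨j, hj⟩ := Finite.exists_min r
        exact ⟨r j, hr0 j, hj⟩
    exact ⟨min m (1 / ((n : ℝ) + 1)), by positivity, min_le_right _ _, fun φ hφ i =>
      hr i φ (hφ.trans_le ((min_le_left _ _).trans (hm i)))⟩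
  choose r hr0 hr1 hr using hchoice
  -- The bounded ratio `rOut / rIn = 2` is what Lebesgue differentiation requires for almost
  -- everywhere convergence.
  let φ : ℕ → ContDiffBump (0 : EuclideanSpace ℝ (Fin N)) := fun n =>
    { rIn := r n / 4, rOut := r n / 2, rIn_pos := by have := hr0 n; positivity,
      rIn_lt_rOut := by have := hr0 n; linarith }
  have hφ0 : Tendsto (fun n => (φ n).rOut) atTop (𝓝 0) := by
    refine squeeze_zero (fun n => (φ n).rOut_pos.le) (fun n => ?_)
      tendsto_one_div_add_atTop_nhds_zero_nat
    have := hr0 n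
    exact le_trans (by change r n / 2 ≤ r n; linarith) (hr1 n)
  have hφK : ∀ᶠ n in atTop, (φ n).rOut ≤ 2 * (φ n).rIn :=
    Eventually.of_forall fun n => le_of_eq (by change r n / 2 = 2 * (r n / 4); ring)
  have hpd (i : Fin N) (n : ℕ) (x : EuclideanSpace ℝ (Fin N)) :=
    partialDeriv_normed_convolution hu (hDu i).1 (φ n) x
  -- The `n`-th error has integral at most `2⁻ⁿ` over `K`, so the sum of all errors is integrable
  -- there and dominates each of them.
  let F : Fin N → EuclideanSpace ℝ (Fin N) → ℝ≥0∞ := fun i x =>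
    ∑' n, ‖((φ n).normed volume ⋆[lsmul ℝ ℝ, volume] Du i) x - Du i x‖ₑ ^ p i
  have hmeas (i : Fin N) (n : ℕ) : AEMeasurable (fun x =>
      ‖((φ n).normed volume ⋆[lsmul ℝ ℝ, volume] Du i) x - Du i x‖ₑ ^ p i)
      (volume.restrict K) := by
    refine (AEStronglyMeasurable.enorm ?_).pow_const _
    exact ((((φ n).hasCompactSupport_normed.continuous_convolution_left _
      (φ n).continuous_normed (hDu i).1.1).aestronglyMeasurable).sub
        (hDu i).1.1.aestronglyMeasurable).restrict
  have hFi (i : Fin N) : ∫⁻ x in K, F i x ≠ ∞ := by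
    rw [lintegral_tsum (hmeas i)]
    refine ne_top_of_le_ne_top (b := ∑' n : ℕ, (2⁻¹ : ℝ≥0∞) ^ n) ?_ (ENNReal.tsum_le_tsum fun n => ?_)
    · rw [ENNReal.tsum_geometric, ENNReal.one_sub_inv_two, inv_inv]; simp
    · refine hr n (φ n) ?_ i
      have := hr0 n
      change r n / 2 < r n
      linarith
  have hFm (i : Fin N) : AEMeasurable (F i) (volume.restrict K) := AEMeasurable.tsum (hmeas i)
  refine ⟨fun n => (φ n).normed volume ⋆[lsmul ℝ ℝ, volume] u, fun i x => (F i x).toReal,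
    fun n => ?_, fun n x => ?_, ?_, fun i => ?_, fun i => ?_, fun i => ?_⟩
  · exact (φ n).hasCompactSupport_normed.contDiff_convolution_left _ (φ n).contDiff_normed hu
  · refine integral_nonneg_of_ae ?_
    have : ∀ᵐ t, 0 < u (x - t) :=
      (quasiMeasurePreserving_sub_left (volume : Measure (EuclideanSpace ℝ (Fin N))) x).ae hpos
    filter_upwards [this] with t ht
    exact mul_nonneg ((φ n).nonneg_normed t) ht.le
  · exact ContDiffBump.ae_convolution_tendsto_right_of_locallyIntegrable hφ0 hφK hu
  · simp only [hpd]
    exact ContDiffBump.ae_convolution_tendsto_right_of_locallyIntegrable hφ0 hφK (hDu i).1.1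
  · exact integrable_toReal_of_lintegral_ne_top (hFm i) (hFi i)
  · filter_upwards [ae_lt_top' (hFm i) (hFi i)] with x hx n
    rw [hpd]
    have h1 := ENNReal.toReal_mono hx.ne (ENNReal.le_tsum (f := fun n =>
      ‖((φ n).normed volume ⋆[lsmul ℝ ℝ, volume] Du i) x - Du i x‖ₑ ^ p i) n)
    rwa [← ENNReal.toReal_rpow, toReal_enorm, Real.norm_eq_abs] at h1

end AnisotropicStable

end Mollification

/-! ### Admissible test functions beyond `C¹`, by dominated convergence. -/

section TestFunctions

open Set Filter Topology

namespace AnisotropicStable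

variable {N : ℕ}

theorem partialDeriv_eq_zero_of_notMem_tsupport {i : Fin N} {φ : EuclideanSpace ℝ (Fin N) → ℝ}
    {x : EuclideanSpace ℝ (Fin N)} (hx : x ∉ tsupport φ) : partialDeriv i φ x = 0 := by
  have : fderiv ℝ φ x = 0 := by
    by_contra h
    exact hx (support_fderiv_subset ℝ h)
  simp [partialDeriv, this]

theorem continuous_partialDeriv {i : Fin N} {φ : EuclideanSpace ℝ (Fin N) → ℝ}
    (hφ : ContDiff ℝ 1 φ) : Continuous (partialDeriv i φ) :=
  (hφ.continuous_fderiv one_ne_zero).clm_apply continuous_const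

theorem exists_bound_partialDeriv {φ : EuclideanSpace ℝ (Fin N) → ℝ}
    (hφ : ContDiff ℝ 1 φ) (hc : HasCompactSupport φ) :
    ∃ M, 0 ≤ M ∧ ∀ i x, |partialDeriv i φ x| ≤ M := by
  obtain ⟨M, hM⟩ := (hc.fderiv ℝ).exists_bound_of_continuous (hφ.continuous_fderiv one_ne_zero)
  refine ⟨M, (norm_nonneg _).trans (hM 0), fun i x => ?_⟩
  calc |partialDeriv i φ x| ≤ ‖fderiv ℝ φ x‖ * ‖EuclideanSpace.single i (1 : ℝ)‖ :=
        (fderiv ℝ φ x).le_opNorm _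
    _ ≤ M := by simpa using hM x

/-- Dominated convergence for functions vanishing outside a fixed compact set. -/
theorem integrable_and_tendsto_integral_of_dominated_on
    {K : Set (EuclideanSpace ℝ (Fin N))} (hK : IsCompact K)
    {F : ℕ → EuclideanSpace ℝ (Fin N) → ℝ} {G b : EuclideanSpace ℝ (Fin N) → ℝ}
    (hF : ∀ n, AEStronglyMeasurable (F n) volume) (hoff : ∀ n, ∀ x ∉ K, F n x = 0)
    (hb : IntegrableOn b K volume)
    (hle : ∀ᵐ x ∂(volume.restrict K), ∀ n, |F n x| ≤ b x)
    (hlim : ∀ᵐ x, Tendsto (fun n => F n x) atTop (𝓝 (G x))) :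
    Integrable G volume ∧ Tendsto (fun n => ∫ x, F n x) atTop (𝓝 (∫ x, G x)) := by
  have hbi : Integrable (K.indicator b) volume := (integrable_indicator_iff hK.measurableSet).2 hb
  have hbd (n : ℕ) : ∀ᵐ x, ‖F n x‖ ≤ K.indicator b x := by
    filter_upwards [(ae_restrict_iff' hK.measurableSet).1 hle] with x hx
    by_cases hxK : x ∈ K
    · rw [indicator_of_mem hxK]; exact hx hxK n
    · rw [indicator_of_notMem hxK, hoff n x hxK, norm_zero]
  exact ⟨⟨aestronglyMeasurable_of_tendsto_ae _ hF hlim,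
    hasFiniteIntegral_of_dominated_convergence hbi.2 hbd hlim⟩,
    tendsto_integral_of_dominated_convergence _ hF hbi hbd hlim⟩

/-- `φ n` is a sequence of `C¹` functions supported in `K` which converges to `Φ`, and whose
partial derivatives converge to `P i`, boundedly and with `L ^ (p i)` domination respectively. -/
structure IsTestSequence (p : Fin N → ℝ) (K : Set (EuclideanSpace ℝ (Fin N)))
    (φ : ℕ → EuclideanSpace ℝ (Fin N) → ℝ) (Φ : EuclideanSpace ℝ (Fin N) → ℝ)
    (P : Fin N → EuclideanSpace ℝ (Fin N) → ℝ) : Prop where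
  contDiff : ∀ n, ContDiff ℝ 1 (φ n)
  tsupport_subset : ∀ n, tsupport (φ n) ⊆ K
  bounded : ∃ M, ∀ n x, |φ n x| ≤ M
  tendsto : ∀ᵐ x, Tendsto (fun n => φ n x) atTop (𝓝 (Φ x))
  tendsto_partialDeriv : ∀ i, ∀ᵐ x,
    Tendsto (fun n => partialDeriv i (φ n) x) atTop (𝓝 (P i x))
  dominated : ∀ i, ∃ S : EuclideanSpace ℝ (Fin N) → ℝ, IntegrableOn S K volume ∧
    ∀ᵐ x ∂(volume.restrict K), ∀ n, |partialDeriv i (φ n) x| ^ p i ≤ S x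

theorem MemLpLoc.integrableOn_rpow {r : ℝ} (hr : 0 < r) {v : EuclideanSpace ℝ (Fin N) → ℝ}
    (hv : MemLpLoc r v) {K : Set (EuclideanSpace ℝ (Fin N))} (hK : IsCompact K) :
    IntegrableOn (fun x => |v x| ^ r) K volume := by
  have := (hv K hK).integrable_norm_rpow (by simpa using hr) (by simp)
  simpa [ENNReal.toReal_ofReal hr.le, IntegrableOn] using this

/-- With `s + t = p i` this dominates `|Du| ^ (p - 1) |∂φ|` and `|Du| ^ (p - 2) |∂φ|²` by `|Du| ^ p
+ |∂φ| ^ p`; positivity of the exponent `p - 2` is where `p i > 2` enters. -/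
theorem rpow_mul_le_add {a b s t : ℝ} (ha : 0 ≤ a) (hb : 0 ≤ b) (hs : 0 < s) (ht : 0 < t) :
    a ^ s * b ^ t ≤ a ^ (s + t) + b ^ (s + t) := by
  rcases le_total a b with h | h
  · calc a ^ s * b ^ t ≤ b ^ s * b ^ t := by gcongr
      _ = b ^ (s + t) := (Real.rpow_add_of_nonneg hb hs.le ht.le).symm
      _ ≤ _ := by have := Real.rpow_nonneg ha (s + t); linarith
  · calc a ^ s * b ^ t ≤ a ^ s * a ^ t := by gcongr
      _ = a ^ (s + t) := (Real.rpow_add_of_nonneg ha hs.le ht.le).symm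
      _ ≤ _ := by have := Real.rpow_nonneg hb (s + t); linarith

theorem IsTestSequence.hasCompactSupport {p : Fin N → ℝ} {K : Set (EuclideanSpace ℝ (Fin N))}
    {φ : ℕ → EuclideanSpace ℝ (Fin N) → ℝ} {Φ : EuclideanSpace ℝ (Fin N) → ℝ}
    {P : Fin N → EuclideanSpace ℝ (Fin N) → ℝ} (h : IsTestSequence p K φ Φ P) (hK : IsCompact K)
    (n : ℕ) : HasCompactSupport (φ n) :=
  hK.of_isClosed_subset (isClosed_tsupport _) (h.tsupport_subset n)

theorem aestronglyMeasurable_abs_rpow {v : EuclideanSpace ℝ (Fin N) → ℝ}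
    (hv : AEStronglyMeasurable v volume) (r : ℝ) :
    AEStronglyMeasurable (fun x => |v x| ^ r) volume :=
  (hv.aemeasurable.abs.pow_const r).aestronglyMeasurable

section Limits

variable {p : Fin N → ℝ} {K : Set (EuclideanSpace ℝ (Fin N))}
  {φ : ℕ → EuclideanSpace ℝ (Fin N) → ℝ} {Φ : EuclideanSpace ℝ (Fin N) → ℝ}
  {P : Fin N → EuclideanSpace ℝ (Fin N) → ℝ}
  {u : EuclideanSpace ℝ (Fin N) → ℝ} {Du : Fin N → EuclideanSpace ℝ (Fin N) → ℝ}

theorem IsTestSequence.tendsto_integral_mul (h : IsTestSequence p K φ Φ P) (hK : IsCompact K)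
    {f : EuclideanSpace ℝ (Fin N) → ℝ} (hf : LocallyIntegrable f volume) :
    Integrable (fun x => f x * Φ x) volume ∧
      Tendsto (fun n => ∫ x, f x * φ n x) atTop (𝓝 (∫ x, f x * Φ x)) := by
  obtain ⟨M, hM⟩ := h.bounded
  refine integrable_and_tendsto_integral_of_dominated_on hK (b := fun x => ‖f x‖ * M)
    (fun n => hf.aestronglyMeasurable.mul (h.contDiff n).continuous.aestronglyMeasurable)
    (fun n x hx => ?_) ((hf.integrableOn_isCompact hK).norm.mul_const M) ?_ ?_
  · rw [image_eq_zero_of_notMem_tsupport fun hx' => hx (h.tsupport_subset n hx'), mul_zero]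
  · refine Eventually.of_forall fun x n => ?_
    rw [abs_mul]
    exact mul_le_mul_of_nonneg_left (hM n x) (abs_nonneg _)
  · filter_upwards [h.tendsto] with x hx using hx.const_mul _

theorem IsTestSequence.tendsto_integral_mul_sq (h : IsTestSequence p K φ Φ P) (hK : IsCompact K)
    {f : EuclideanSpace ℝ (Fin N) → ℝ} (hf : LocallyIntegrable f volume) :
    Integrable (fun x => f x * Φ x ^ 2) volume ∧
      Tendsto (fun n => ∫ x, f x * φ n x ^ 2) atTop (𝓝 (∫ x, f x * Φ x ^ 2)) := by
  obtain ⟨M, hM⟩ := h.bounded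
  refine integrable_and_tendsto_integral_of_dominated_on hK (b := fun x => ‖f x‖ * M ^ 2)
    (fun n => hf.aestronglyMeasurable.mul ((h.contDiff n).continuous.pow 2).aestronglyMeasurable)
    (fun n x hx => ?_) ((hf.integrableOn_isCompact hK).norm.mul_const _) ?_ ?_
  · rw [image_eq_zero_of_notMem_tsupport fun hx' => hx (h.tsupport_subset n hx')]; simp
  · refine Eventually.of_forall fun x n => ?_
    rw [abs_mul, abs_pow]
    exact mul_le_mul_of_nonneg_left (pow_le_pow_left₀ (abs_nonneg _) (hM n x) 2) (abs_nonneg _)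
  · filter_upwards [h.tendsto] with x hx using (hx.pow 2).const_mul _

theorem IsTestSequence.tendsto_integral_flux (h : IsTestSequence p K φ Φ P) (hK : IsCompact K)
    (hDu : IsWeakGradient p u Du) (hp : ∀ i, 2 < p i) (i : Fin N) :
    Integrable (fun x => |Du i x| ^ (p i - 2) * Du i x * P i x) volume ∧
      Tendsto (fun n => ∫ x, |Du i x| ^ (p i - 2) * Du i x * partialDeriv i (φ n) x) atTop
        (𝓝 (∫ x, |Du i x| ^ (p i - 2) * Du i x * P i x)) := by
  obtain ⟨S, hS, hSle⟩ := h.dominated i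
  have hpi := hp i
  have hm := (hDu i).1.1.aestronglyMeasurable
  refine integrable_and_tendsto_integral_of_dominated_on hK
    (b := fun x => |Du i x| ^ p i + S x)
    (fun n => ((aestronglyMeasurable_abs_rpow hm _).mul hm).mul
      (continuous_partialDeriv (h.contDiff n)).aestronglyMeasurable)
    (fun n x hx => ?_) (((hDu i).2.integrableOn_rpow (by linarith) hK).add hS) ?_ ?_
  · rw [partialDeriv_eq_zero_of_notMem_tsupport fun hx' => hx (h.tsupport_subset n hx'), mul_zero]
  · filter_upwards [hSle] with x hx n
    rw [abs_mul, abs_mul, abs_of_nonneg (Real.rpow_nonneg (abs_nonneg (Du i x)) (p i - 2))]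
    have h1 : |Du i x| ^ (p i - 2) * |Du i x| = |Du i x| ^ (p i - 1) := by
      rw [show p i - 1 = p i - 2 + 1 by ring,
        Real.rpow_add_of_nonneg (abs_nonneg _) (by linarith) zero_le_one, Real.rpow_one]
    have h2 := rpow_mul_le_add (abs_nonneg (Du i x)) (abs_nonneg (partialDeriv i (φ n) x))
      (show 0 < p i - 1 by linarith) one_pos
    rw [Real.rpow_one, sub_add_cancel] at h2
    rw [h1]
    exact h2.trans (by have := hx n; gcongr)
  · filter_upwards [h.tendsto_partialDeriv i] with x hx using hx.const_mul _

theorem IsTestSequence.tendsto_integral_quadratic (h : IsTestSequence p K φ Φ P)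
    (hK : IsCompact K) (hDu : IsWeakGradient p u Du) (hp : ∀ i, 2 < p i) (i : Fin N) :
    Integrable (fun x => |Du i x| ^ (p i - 2) * P i x ^ 2) volume ∧
      Tendsto (fun n => ∫ x, |Du i x| ^ (p i - 2) * |partialDeriv i (φ n) x| ^ 2) atTop
        (𝓝 (∫ x, |Du i x| ^ (p i - 2) * P i x ^ 2)) := by
  obtain ⟨S, hS, hSle⟩ := h.dominated i
  have hpi := hp i
  have hm := (hDu i).1.1.aestronglyMeasurable
  simp only [sq_abs]
  refine integrable_and_tendsto_integral_of_dominated_on hK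
    (b := fun x => |Du i x| ^ p i + S x)
    (fun n => (aestronglyMeasurable_abs_rpow hm _).mul
      ((continuous_partialDeriv (h.contDiff n)).pow 2).aestronglyMeasurable)
    (fun n x hx => ?_) (((hDu i).2.integrableOn_rpow (by linarith) hK).add hS) ?_ ?_
  · rw [partialDeriv_eq_zero_of_notMem_tsupport fun hx' => hx (h.tsupport_subset n hx')]; simp
  · filter_upwards [hSle] with x hx n
    rw [abs_mul, abs_pow, abs_of_nonneg (Real.rpow_nonneg (abs_nonneg (Du i x)) (p i - 2))]
    have h2 := rpow_mul_le_add (abs_nonneg (Du i x)) (abs_nonneg (partialDeriv i (φ n) x))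
      (show 0 < p i - 2 by linarith) two_pos
    rw [Real.rpow_two, sub_add_cancel] at h2
    exact h2.trans (by have := hx n; gcongr)
  · filter_upwards [h.tendsto_partialDeriv i] with x hx using (hx.pow 2).const_mul _

end Limits

theorem partialDeriv_rpow_neg_mul {w ζ : EuclideanSpace ℝ (Fin N) → ℝ} (hw : ContDiff ℝ 1 w)
    (hw0 : ∀ x, 0 ≤ w x) (hζ : ContDiff ℝ 1 ζ) (a : ℝ) (i : Fin N)
    (x : EuclideanSpace ℝ (Fin N)) :
    partialDeriv i (fun y => (1 + w y) ^ (-a) * ζ y) x =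
      -a * (1 + w x) ^ (-a - 1) * partialDeriv i w x * ζ x
        + (1 + w x) ^ (-a) * partialDeriv i ζ x := by
  have hne : 1 + w x ≠ 0 := by have := hw0 x; positivity
  have h1 := (((hw.differentiable one_ne_zero x).hasFDerivAt.const_add 1).rpow_const
    (p := -a) (Or.inl hne)).mul (hζ.differentiable one_ne_zero x).hasFDerivAt
  rw [partialDeriv, show (fun y => (1 + w y) ^ (-a) * ζ y) = (fun y => (1 + w y) ^ (-a)) * ζ from rfl,
    h1.fderiv]
  simp only [add_apply, smul_apply, smul_eq_mul,
    partialDeriv]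
  ring

theorem contDiff_rpow_neg_mul {w ζ : EuclideanSpace ℝ (Fin N) → ℝ} (hw : ContDiff ℝ 1 w)
    (hw0 : ∀ x, 0 ≤ w x) (hζ : ContDiff ℝ 1 ζ) (a : ℝ) :
    ContDiff ℝ 1 (fun y => (1 + w y) ^ (-a) * ζ y) :=
  ((contDiff_const.add hw).rpow_const_of_ne fun x => by
    have := hw0 x; positivity).mul hζ

/-- The function `(1 + u) ^ (-a) ζ` can be used as a test function. -/
theorem exists_isTestSequence {p : Fin N → ℝ} (hp : ∀ i, 1 ≤ p i)
    {u : EuclideanSpace ℝ (Fin N) → ℝ} (hu : LocallyIntegrable u volume) (hpos : ∀ᵐ x, 0 < u x)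
    {Du : Fin N → EuclideanSpace ℝ (Fin N) → ℝ} (hDu : IsWeakGradient p u Du)
    {a : ℝ} (ha : 0 ≤ a) {ζ : EuclideanSpace ℝ (Fin N) → ℝ} (hζ : ContDiff ℝ 1 ζ)
    (hζc : HasCompactSupport ζ) :
    ∃ φ, IsTestSequence p (tsupport ζ) φ (fun x => (1 + u x) ^ (-a) * ζ x)
      (fun i x => -a * (1 + u x) ^ (-a - 1) * Du i x * ζ x
        + (1 + u x) ^ (-a) * partialDeriv i ζ x) := by
  obtain ⟨w, S, hw, hw0, hwu, hwD, hS, hSle⟩ := exists_smooth_approximation hp hu hpos hDu hζc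
  obtain ⟨M, hM⟩ := hζc.exists_bound_of_continuous hζ.continuous
  have hM0 : 0 ≤ M := (norm_nonneg _).trans (hM 0)
  obtain ⟨M', hM'0, hM'⟩ := exists_bound_partialDeriv hζ hζc
  have hv1 (b : ℝ) (hb : 0 ≤ b) (n : ℕ) (x : EuclideanSpace ℝ (Fin N)) :
      0 ≤ (1 + w n x) ^ (-b) ∧ (1 + w n x) ^ (-b) ≤ 1 := by
    have := hw0 n x
    exact ⟨by positivity, Real.rpow_le_one_of_one_le_of_nonpos (by linarith) (by linarith)⟩
  have hlim (b : ℝ) : ∀ᵐ x, Tendsto (fun n => (1 + w n x) ^ b) atTop (𝓝 ((1 + u x) ^ b)) := by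
    filter_upwards [hwu, hpos] with x hx hux
    exact (hx.const_add 1).rpow_const (Or.inl (by positivity))
  refine ⟨fun n x => (1 + w n x) ^ (-a) * ζ x, fun n => contDiff_rpow_neg_mul (hw n) (hw0 n) hζ a,
    fun n => tsupport_mul_subset_right, ⟨M, fun n x => ?_⟩, ?_, fun i => ?_, fun i => ?_⟩
  · rw [abs_mul, abs_of_nonneg (hv1 a ha n x).1]
    exact (mul_le_of_le_one_left (abs_nonneg _) (hv1 a ha n x).2).trans (hM x)
  · filter_upwards [hlim (-a)] with x hx using hx.mul_const _
  · filter_upwards [hlim (-a), hlim (-a - 1), hwD i] with x hx hx' hxD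
    simp only [partialDeriv_rpow_neg_mul (hw _) (hw0 _) hζ]
    exact (((hx'.const_mul _).mul hxD).mul_const _).add (hx.mul_const _)
  · have hpi := hp i
    set C := a * M + M' with hC
    have hC0 : 0 ≤ C := by positivity
    refine ⟨fun x => (3 * C) ^ p i * (S i x + |Du i x| ^ p i + 1), ?_, ?_⟩
    · exact (((hS i).add ((hDu i).2.integrableOn_rpow (by linarith) hζc)).add
        (integrableOn_const hζc.measure_lt_top.ne)).const_mul _
    · filter_upwards [hSle i] with x hx n
      rw [partialDeriv_rpow_neg_mul (hw _) (hw0 _) hζ]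
      set d := |partialDeriv i (w n) x - Du i x| with hd
      have hd0 : 0 ≤ d := abs_nonneg _
      have hD0 : 0 ≤ |Du i x| := abs_nonneg _
      have hDn : |partialDeriv i (w n) x| ≤ d + |Du i x| := by
        have := abs_add_le (partialDeriv i (w n) x - Du i x) (Du i x)
        rwa [sub_add_cancel] at this
      have hA := hv1 (a + 1) (by linarith) n x
      rw [neg_add'] at hA
      have hB := hv1 a ha n x
      have h1 : |-a * (1 + w n x) ^ (-a - 1) * partialDeriv i (w n) x * ζ x|
          ≤ a * M * (d + |Du i x|) := by
        rw [abs_mul, abs_mul, abs_mul, abs_neg, abs_of_nonneg ha, abs_of_nonneg hA.1]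
        calc a * (1 + w n x) ^ (-a - 1) * |partialDeriv i (w n) x| * |ζ x|
            ≤ a * 1 * (d + |Du i x|) * M := by
              gcongr
              · exact hA.2
              · exact hM x
          _ = _ := by ring
      have h2 : |(1 + w n x) ^ (-a) * partialDeriv i ζ x| ≤ M' := by
        rw [abs_mul, abs_of_nonneg hB.1]
        exact (mul_le_of_le_one_left (abs_nonneg _) hB.2).trans (hM' i x)
      -- Bounding by the maximum makes its `p i`-th power equal to that of one of the three
      -- quantities.
      set m := max (max d |Du i x|) 1 with hm
      have hmd : d ≤ m := (le_max_left _ _).trans (le_max_left _ _)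
      have hmD : |Du i x| ≤ m := (le_max_right _ _).trans (le_max_left _ _)
      have hm1 : 1 ≤ m := le_max_right _ _
      have h3 : |-a * (1 + w n x) ^ (-a - 1) * partialDeriv i (w n) x * ζ x
          + (1 + w n x) ^ (-a) * partialDeriv i ζ x| ≤ 3 * C * m := by
        refine (abs_add_le _ _).trans ((add_le_add h1 h2).trans ?_)
        have haM : 0 ≤ a * M := by positivity
        rw [hC]
        nlinarith [mul_nonneg haM (sub_nonneg.2 hmd), mul_nonneg haM (sub_nonneg.2 hmD),
          mul_nonneg hM'0 (sub_nonneg.2 hm1), mul_nonneg haM (zero_le_one.trans hm1)]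
      have hmp : m ^ p i ≤ S i x + |Du i x| ^ p i + 1 := by
        have e1 : d ^ p i ≤ S i x := hx n
        have e0 : 0 ≤ d ^ p i := by positivity
        have e2 : 0 ≤ |Du i x| ^ p i := by positivity
        rcases max_choice (max d |Du i x|) 1 with h | h
        · rcases max_choice d |Du i x| with h' | h'
          · rw [hm, h, h']; linarith
          · rw [hm, h, h']; linarith
        · rw [hm, h, Real.one_rpow]; linarith
      calc _ ≤ (3 * C * m) ^ p i := Real.rpow_le_rpow (abs_nonneg _) h3 (by linarith)
        _ = (3 * C) ^ p i * m ^ p i := Real.mul_rpow (by positivity) (by positivity)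
        _ ≤ _ := by gcongr

end AnisotropicStable

end TestFunctions

/-! ### Pointwise inequalities. -/

section Inequalities

open Set Filter Topology

namespace AnisotropicStable

variable {N : ℕ}

/-- Absorption of the cross terms in the combination of stability and the weak form. -/
theorem exists_quadratic_lower_bound {p lam β m : ℝ} (hp : 2 < p)
    (h : (p - 1) * β ^ 2 < lam * (2 * β + 1)) :
    ∃ C, 0 ≤ C ∧ ∀ D b : ℝ, -(C * |b| ^ p) ≤
      -((p - 1) * (|D| ^ (p - 2) * (-β * D + m * b) ^ 2))
        - lam * (|D| ^ (p - 2) * D * (-(2 * β + 1) * D + 2 * m * b)) := by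
  set s := lam * (2 * β + 1) - (p - 1) * β ^ 2 with hs
  have hs0 : 0 < s := by linarith
  set k := 2 * m * lam - 2 * β * m * (p - 1) with hk
  set e := (p - 1) * m ^ 2 with he
  have he0 : 0 ≤ e := mul_nonneg (by linarith) (sq_nonneg _)
  have hk0 := abs_nonneg k
  -- `η` is so small that for `|b| ≤ η |D|` the term `s D²` dominates the other two, using `η² ≤ η`.
  -- In the other case `|D| ≤ |b| / η`, and everything is controlled by `|b| ^ p`.
  obtain ⟨η, hη0, hη1, hη⟩ : ∃ η : ℝ, 0 < η ∧ η ≤ 1 ∧ η * (|k| + e) ≤ s := by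
    refine ⟨min 1 (s / (|k| + e + 1)), by positivity, min_le_left _ _, ?_⟩
    calc _ ≤ s / (|k| + e + 1) * (|k| + e + 1) := by
          exact mul_le_mul (min_le_right _ _) (by linarith) (by positivity) (by positivity)
      _ = s := div_mul_cancel₀ _ (by positivity)
  refine ⟨(1 / η) ^ (p - 2) * (|k| / η + e), by positivity, fun D b => ?_⟩
  have ha0 : 0 ≤ |D| ^ (p - 2) := by positivity
  have hexp : -((p - 1) * (|D| ^ (p - 2) * (-β * D + m * b) ^ 2))
        - lam * (|D| ^ (p - 2) * D * (-(2 * β + 1) * D + 2 * m * b))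
        = |D| ^ (p - 2) * (s * |D| ^ 2 - k * (D * b) - e * |b| ^ 2) := by
    rw [hs, hk, he, sq_abs, sq_abs]; ring
  have hkDb : k * (D * b) ≤ |k| * (|D| * |b|) := by
    rw [← abs_mul, ← abs_mul]; exact le_abs_self _
  have hD0 := abs_nonneg D
  have hb0 := abs_nonneg b
  rw [hexp]
  rcases le_total |b| (η * |D|) with hb | hb
  · have h1 : 0 ≤ s * |D| ^ 2 - k * (D * b) - e * |b| ^ 2 := by
      have h2 : |k| * (|D| * |b|) ≤ |k| * (|D| * (η * |D|)) := by gcongr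
      have h3 : e * |b| ^ 2 ≤ e * (η * |D|) ^ 2 := by gcongr
      have h4 : η ^ 2 ≤ η := by nlinarith
      have h5 : e * (η * |D|) ^ 2 ≤ e * η * |D| ^ 2 := by
        rw [mul_pow, ← mul_assoc]; gcongr
      have h6 : η * (|k| + e) * |D| ^ 2 ≤ s * |D| ^ 2 := by gcongr
      nlinarith
    exact (neg_nonpos.2 (by positivity)).trans (mul_nonneg ha0 h1)
  · have hDb : |D| ≤ 1 / η * |b| := by
      rw [one_div, ← div_eq_inv_mul, le_div_iff₀ hη0]; linarith
    have h1 : |D| ^ (p - 2) ≤ (1 / η) ^ (p - 2) * |b| ^ (p - 2) := by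
      rw [← Real.mul_rpow (by positivity) hb0]
      exact Real.rpow_le_rpow hD0 hDb (by linarith)
    have h2 : -((|k| / η + e) * |b| ^ 2) ≤ s * |D| ^ 2 - k * (D * b) - e * |b| ^ 2 := by
      have h3 : |k| * (|D| * |b|) ≤ |k| * (1 / η * |b| * |b|) := by gcongr
      have h4 : 0 ≤ s * |D| ^ 2 := by positivity
      have h5 : |k| * (1 / η * |b| * |b|) = |k| / η * |b| ^ 2 := by ring
      linarith
    have hbp : |b| ^ p = |b| ^ (p - 2) * |b| ^ 2 := by
      rw [← Real.rpow_two, ← Real.rpow_add_of_nonneg hb0 (by linarith) (by norm_num)]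
      ring_nf
    calc _ = ((1 / η) ^ (p - 2) * |b| ^ (p - 2)) * -((|k| / η + e) * |b| ^ 2) := by
          rw [hbp]; ring
      _ ≤ |D| ^ (p - 2) * -((|k| / η + e) * |b| ^ 2) :=
          mul_le_mul_of_nonpos_right h1 (neg_nonpos.2 (by positivity))
      _ ≤ _ := by gcongr

/-- Young's inequality with the exponent `κ / (θ - p)` and its conjugate, in weighted form. -/
theorem exists_young_bound {p θ κ η : ℝ} (hθ : p < θ) (hp : 0 < p) (hκ : 0 < p + κ - θ)
    (hη : 0 < η) :
    ∃ C, 0 ≤ C ∧ ∀ v r : ℝ, 0 < v → 0 ≤ r →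
      v ^ (-θ) * (v * r) ^ p ≤ η * v ^ (-κ) + C * r ^ (p * κ / (p + κ - θ)) := by
  set t := (θ - p) / (p + κ - θ) with ht
  have ht0 : 0 < t := div_pos (by linarith) hκ
  refine ⟨η ^ (-t), by positivity, fun v r hv hr => ?_⟩
  have e1 : v ^ (-θ) * (v * r) ^ p = v ^ (-(θ - p)) * r ^ p := by
    rw [Real.mul_rpow hv.le hr, ← mul_assoc, ← Real.rpow_add hv]; ring_nf
  rw [e1]
  -- The tested quantity is the ratio of the left side to `v ^ (-κ)`. When it exceeds `η`, its power
  -- `-t` is at most `η ^ (-t)`, and `t` is chosen so that this eliminates `v`.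
  rcases le_or_gt (v ^ (p + κ - θ) * r ^ p) η with h | h
  · have e2 : v ^ (-(θ - p)) * r ^ p = v ^ (p + κ - θ) * r ^ p * v ^ (-κ) := by
      rw [mul_right_comm, ← Real.rpow_add hv]; ring_nf
    rw [e2]
    have h1 : v ^ (p + κ - θ) * r ^ p * v ^ (-κ) ≤ η * v ^ (-κ) := by gcongr
    have h2 : 0 ≤ η ^ (-t) * r ^ (p * κ / (p + κ - θ)) := by positivity
    linarith
  · have hr0 : 0 < r := by
      rcases hr.lt_or_eq with h' | h'
      · exact h'
      · rw [← h', Real.zero_rpow hp.ne', mul_zero] at h; linarith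
    have h1 : (v ^ (p + κ - θ) * r ^ p) ^ (-t) ≤ η ^ (-t) :=
      Real.rpow_le_rpow_of_nonpos hη h.le (by linarith)
    have e3 : (v ^ (p + κ - θ) * r ^ p) ^ (-t) = v ^ (-(θ - p)) * r ^ (p * -t) := by
      rw [Real.mul_rpow (by positivity) (by positivity), ← Real.rpow_mul hv.le,
        ← Real.rpow_mul hr]
      congr 2
      rw [ht, mul_neg, mul_div_cancel₀ _ hκ.ne']
    have e4 : v ^ (-(θ - p)) * r ^ p
        = v ^ (-(θ - p)) * r ^ (p * -t) * r ^ (p * κ / (p + κ - θ)) := by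
      rw [mul_assoc, ← Real.rpow_add hr0]
      congr 2
      rw [ht]
      field_simp
      ring
    rw [e4, ← e3]
    have h2 : (v ^ (p + κ - θ) * r ^ p) ^ (-t) * r ^ (p * κ / (p + κ - θ))
        ≤ η ^ (-t) * r ^ (p * κ / (p + κ - θ)) := by gcongr
    have h3 : 0 ≤ η * v ^ (-κ) := by positivity
    linarith

/-- Lower bound for the gradient terms arising from the test functions `v ^ (-β) χ ^ m` (in the
stability inequality) and `v ^ (-(2β+1)) χ ^ (2m)` (in the weak form). -/
theorem exists_gradient_terms_lower_bound {p lam β κ η : ℝ} {m : ℕ} (hm : 2 ≤ m) (hp : 2 < p)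
    (h : (p - 1) * β ^ 2 < lam * (2 * β + 1)) (hθ : p < 2 * β + 2) (hκ : 0 < p + κ - (2 * β + 2))
    (hη : 0 < η) (hσ : p * κ / (p + κ - (2 * β + 2)) ≤ 2 * m) :
    ∃ C, 0 ≤ C ∧ ∀ v χ D d : ℝ, 0 < v → 0 ≤ χ → χ ≤ 1 →
      -(η * (v ^ (-κ) * χ ^ (2 * m)) + C * |d| ^ (p * κ / (p + κ - (2 * β + 2)))) ≤
        -((p - 1) * (|D| ^ (p - 2) *
            (-β * v ^ (-β - 1) * D * χ ^ m + v ^ (-β) * (m * χ ^ (m - 1) * d)) ^ 2))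
          - lam * (|D| ^ (p - 2) * D *
            (-(2 * β + 1) * v ^ (-(2 * β + 1) - 1) * D * χ ^ (2 * m)
              + v ^ (-(2 * β + 1)) * ((2 * m : ℕ) * χ ^ (2 * m - 1) * d))) := by
  obtain ⟨C₁, hC₁, hC₁'⟩ := exists_quadratic_lower_bound (m := m) hp h
  obtain ⟨C₂, hC₂, hC₂'⟩ := exists_young_bound (κ := κ) hθ (by linarith) hκ
    (show 0 < η / (C₁ + 1) by positivity)
  set σ := p * κ / (p + κ - (2 * β + 2))
  refine ⟨C₁ * C₂, by positivity, fun v χ D d hv hχ0 hχ1 => ?_⟩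
  -- Division by `χ` is impossible here; `m ≥ 2` keeps `m - 1` positive, so every term on the right
  -- vanishes whatever `d` is.
  rcases hχ0.eq_or_lt with rfl | hχ
  · have h0 : 0 ≤ C₁ * C₂ * |d| ^ σ := by positivity
    have hm0 : m ≠ 0 := by omega
    have e1 : (0 : ℝ) ^ (2 * m) = 0 := zero_pow (by omega)
    have e2 : (0 : ℝ) ^ m = 0 := zero_pow hm0
    have e3 : (0 : ℝ) ^ (2 * m - 1) = 0 := zero_pow (by omega)
    simp [e1, e2, e3, zero_pow (show m - 1 ≠ 0 by omega), h0]
  · set r := d / χ with hr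
    have hd : d = χ * r := by rw [hr, mul_div_cancel₀ _ hχ.ne']
    set V := v ^ (-β - 1) with hV
    have hV0 : 0 < V := by positivity
    have eβ : v ^ (-β) = V * v := by
      rw [hV, ← Real.rpow_add_one hv.ne']; ring_nf
    have eV : v ^ (-(2 * β + 2)) = V ^ 2 := by
      rw [hV, ← Real.rpow_two, ← Real.rpow_mul hv.le]; ring_nf
    have eα : v ^ (-(2 * β + 1) - 1) = V ^ 2 := by rw [← eV]; ring_nf
    have eα' : v ^ (-(2 * β + 1)) = V ^ 2 * v := by
      rw [← eV, ← Real.rpow_add_one hv.ne']; ring_nf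
    have ep1 : χ ^ (m - 1) * χ = χ ^ m := by rw [← pow_succ]; congr 1; omega
    have ep2 : χ ^ (2 * m - 1) * χ = χ ^ (2 * m) := by rw [← pow_succ]; congr 1; omega
    have ep3 : χ ^ (2 * m) = (χ ^ m) ^ 2 := by rw [← pow_mul]; ring_nf
    have ed1 : χ ^ (m - 1) * d = χ ^ m * r := by rw [hd, ← mul_assoc, ep1]
    have ed2 : χ ^ (2 * m - 1) * d = χ ^ (2 * m) * r := by rw [hd, ← mul_assoc, ep2]
    have hW : 0 ≤ V ^ 2 * χ ^ (2 * m) := by positivity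
    have hquad := mul_le_mul_of_nonneg_left (hC₁' D (v * r)) hW
    have hrhs : -((p - 1) * (|D| ^ (p - 2) *
            (-β * V * D * χ ^ m + v ^ (-β) * (m * χ ^ (m - 1) * d)) ^ 2))
          - lam * (|D| ^ (p - 2) * D *
            (-(2 * β + 1) * v ^ (-(2 * β + 1) - 1) * D * χ ^ (2 * m)
              + v ^ (-(2 * β + 1)) * ((2 * m : ℕ) * χ ^ (2 * m - 1) * d)))
        = V ^ 2 * χ ^ (2 * m) * (-((p - 1) * (|D| ^ (p - 2) * (-β * D + m * (v * r)) ^ 2))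
        - lam * (|D| ^ (p - 2) * D * (-(2 * β + 1) * D + 2 * m * (v * r)))) := by
      rw [mul_assoc (m : ℝ), ed1, mul_assoc ((2 * m : ℕ) : ℝ), ed2, eβ, eα, eα', ep3]
      push_cast
      ring
    rw [hrhs]
    refine le_trans ?_ hquad
    have hyoung := hC₂' v |r| hv (abs_nonneg _)
    rw [eV] at hyoung
    -- The power `m` of the cutoff is taken large for this step: it compensates the division by `χ`
    -- in `r`.
    have hχσ : χ ^ (2 * m) * |r| ^ σ ≤ |d| ^ σ := by
      have : χ ^ (2 * m) ≤ χ ^ σ := by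
        rw [← Real.rpow_natCast]
        exact Real.rpow_le_rpow_of_exponent_ge hχ hχ1 (by push_cast; exact hσ)
      calc χ ^ (2 * m) * |r| ^ σ ≤ χ ^ σ * |r| ^ σ := by gcongr
        _ = |d| ^ σ := by
          rw [← Real.mul_rpow hχ.le (abs_nonneg _), hd, abs_mul, abs_of_pos hχ]
    have hηle : C₁ * (η / (C₁ + 1)) ≤ η := by
      rw [← mul_div_assoc, div_le_iff₀ (by positivity)]; nlinarith
    have hvκ : 0 ≤ v ^ (-κ) * χ ^ (2 * m) := by positivity
    rw [abs_mul, abs_of_pos hv]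
    calc -(η * (v ^ (-κ) * χ ^ (2 * m)) + C₁ * C₂ * |d| ^ σ)
        ≤ -(C₁ * (η / (C₁ + 1)) * (v ^ (-κ) * χ ^ (2 * m))
            + C₁ * C₂ * (χ ^ (2 * m) * |r| ^ σ)) := by gcongr
      _ = -(C₁ * χ ^ (2 * m) * (η / (C₁ + 1) * v ^ (-κ) + C₂ * |r| ^ σ)) := by ring
      _ ≤ -(C₁ * χ ^ (2 * m) * (V ^ 2 * (v * |r|) ^ p)) := by gcongr
      _ = _ := by ring

/-- Lower bound for the terms with the nonlinearity. -/
theorem reaction_terms_lower_bound {u g c δ β lam χ : ℝ} {m : ℕ} (hu : 0 < u) (hc : 0 < c)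
    (hg : c ≤ g) (hδ : 0 < δ) (hlam0 : 0 ≤ lam) (hlam : lam ≤ δ) (hχ : 0 ≤ χ) :
    2 * (δ - lam) * c * ((1 + u) ^ (-(δ + 1 + 2 * β)) * χ ^ (2 * m)) ≤
      g * (2 * δ * u ^ (-δ - 1)) * ((1 + u) ^ (-β) * χ ^ m) ^ 2
        + lam * (g * singularF δ δ u * ((1 + u) ^ (-(2 * β + 1)) * χ ^ (2 * m))) := by
  have hv : 0 < 1 + u := by linarith
  set B := (1 + u) ^ (-(2 * β)) with hB
  have hB0 : 0 < B := by positivity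
  have e1 : (1 + u) ^ (-(δ + 1 + 2 * β)) = (1 + u) ^ (-δ - 1) * B := by
    rw [hB, ← Real.rpow_add hv]; ring_nf
  have e2 : ((1 + u) ^ (-β) * χ ^ m) ^ 2 = B * χ ^ (2 * m) := by
    rw [mul_pow, ← pow_mul, mul_comm m 2, hB, ← Real.rpow_two, ← Real.rpow_mul hv.le]; ring_nf
  have e3 : (1 + u) ^ (-(2 * β + 1)) = B * (1 + u)⁻¹ := by
    rw [hB, ← Real.rpow_neg_one, ← Real.rpow_add hv]; ring_nf
  have e4 : u ^ (-δ) = u ^ (-δ - 1) * u := by rw [← Real.rpow_add_one hu.ne']; ring_nf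
  have h1 : (1 + u) ^ (-δ - 1) ≤ u ^ (-δ - 1) :=
    Real.rpow_le_rpow_of_nonpos hu (by linarith) (by linarith)
  have h2 : u * (1 + u)⁻¹ ≤ 1 := by
    rw [← div_eq_mul_inv, div_le_one hv]; linarith
  have hg0 : 0 < g := hc.trans_le hg
  have hX : 0 ≤ g * u ^ (-δ - 1) * (B * χ ^ (2 * m)) := by positivity
  have hdl : 0 ≤ δ - lam := by linarith
  rw [e1, e2, e3, singularF, e4]
  calc _ = 2 * (δ - lam) * (c * (1 + u) ^ (-δ - 1) * (B * χ ^ (2 * m))) := by ring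
    _ ≤ 2 * (δ - lam) * (g * u ^ (-δ - 1) * (B * χ ^ (2 * m))) := by gcongr
    _ = 2 * δ * (g * u ^ (-δ - 1) * (B * χ ^ (2 * m)))
        - 2 * lam * (g * u ^ (-δ - 1) * (B * χ ^ (2 * m))) * 1 := by ring
    _ ≤ 2 * δ * (g * u ^ (-δ - 1) * (B * χ ^ (2 * m)))
        - 2 * lam * (g * u ^ (-δ - 1) * (B * χ ^ (2 * m))) * (u * (1 + u)⁻¹) := by gcongr
    _ = _ := by ring

theorem deriv_singularF {δ t : ℝ} (ht : 0 < t) :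
    deriv (singularF δ δ) t = 2 * δ * t ^ (-δ - 1) := by
  have h := Real.hasDerivAt_rpow_const (p := -δ) (Or.inl ht.ne')
  have h2 : HasDerivAt (singularF δ δ) (-(-δ * t ^ (-δ - 1) + -δ * t ^ (-δ - 1))) t :=
    (h.add h).neg
  rw [h2.deriv]
  ring

end AnisotropicStable

end Inequalities

/-! ### The integral estimate and its contradiction at large scales. -/

section Nonexistence

open Set Filter Topology Metric

namespace AnisotropicStable

variable {N : ℕ}

theorem partialDeriv_pow {i : Fin N} {χ : EuclideanSpace ℝ (Fin N) → ℝ} (hχ : ContDiff ℝ 1 χ)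
    (k : ℕ) (x : EuclideanSpace ℝ (Fin N)) :
    partialDeriv i (fun y => χ y ^ k) x = k * χ x ^ (k - 1) * partialDeriv i χ x := by
  have h := (hχ.differentiable one_ne_zero x).hasFDerivAt.pow k
  rw [partialDeriv, h.fderiv]
  simp [partialDeriv]

theorem integrable_rpow_neg_mul {u : EuclideanSpace ℝ (Fin N) → ℝ}
    (hu : LocallyIntegrable u volume) (hpos : ∀ᵐ x, 0 < u x) {κ : ℝ} (hκ : 0 ≤ κ)
    {ζ : EuclideanSpace ℝ (Fin N) → ℝ} (hζ : Continuous ζ) (hζc : HasCompactSupport ζ) :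
    Integrable (fun x => (1 + u x) ^ (-κ) * ζ x) volume := by
  refine (hζ.integrable_of_hasCompactSupport hζc).mono ?_ ?_
  · exact ((hu.aestronglyMeasurable.aemeasurable.const_add 1).pow_const _).aestronglyMeasurable.mul
      hζ.aestronglyMeasurable
  · filter_upwards [hpos] with x hx
    rw [norm_mul, Real.norm_of_nonneg (by positivity)]
    exact mul_le_of_le_one_left (norm_nonneg _)
      (Real.rpow_le_one_of_one_le_of_nonpos (by linarith) (by linarith))

/-- A stable solution satisfies an integral estimate involving only the derivatives of the cutoff
function on the right-hand side. -/
theorem IsStableSolution.exists_integral_estimate (hN : 1 ≤ N) {p : Fin N → ℝ} (hp : ∀ i, 2 < p i)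
    {g u : EuclideanSpace ℝ (Fin N) → ℝ} {c δ lam β κ : ℝ} {m : ℕ} (hc : 0 < c)
    (hgc : ∀ᵐ x, c ≤ g x) (hδ : 0 < δ) (hβ : 0 ≤ β) (hlam0 : 0 ≤ lam) (hlam : lam < δ)
    (hm : 2 ≤ m) (hβlam : ∀ i, (p i - 1) * β ^ 2 < lam * (2 * β + 1))
    (hθ : ∀ i, p i < 2 * β + 2) (hκ : κ = δ + 1 + 2 * β)
    (hκ' : ∀ i, 0 < p i + κ - (2 * β + 2))
    (hσ : ∀ i, p i * κ / (p i + κ - (2 * β + 2)) ≤ 2 * m)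
    (hsol : IsStableSolution p g (singularF δ δ) u) :
    ∃ C, 0 ≤ C ∧ ∀ χ : EuclideanSpace ℝ (Fin N) → ℝ, ContDiff ℝ 1 χ → HasCompactSupport χ →
      (∀ x, 0 ≤ χ x) → (∀ x, χ x ≤ 1) →
      ∫ x, (1 + u x) ^ (-κ) * χ x ^ (2 * m) ≤
        C * ∑ i, ∫ x, |partialDeriv i χ x| ^ (p i * κ / (p i + κ - (2 * β + 2))) := by
  have hN0 : (0 : ℝ) < N := by exact_mod_cast hN
  set σ : Fin N → ℝ := fun i => p i * κ / (p i + κ - (2 * β + 2))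
  have hκ0 : 0 < κ := by rw [hκ]; positivity
  have hσpos (i : Fin N) : 0 < σ i := div_pos (mul_pos (by linarith [hp i]) hκ0) (hκ' i)
  have hdl : 0 < (δ - lam) * c := mul_pos (by linarith) hc
  -- With this share in each of the `N` directions, Young's inequality absorbs exactly half of the
  -- coefficient `2 (δ - lam) c`.
  have hη : 0 < (δ - lam) * c / N := by positivity
  have hgrad := fun i => exists_gradient_terms_lower_bound hm (hp i) (hβlam i) (hθ i) (hκ' i) hη
    (hσ i)
  choose C hC0 hC using hgrad
  obtain ⟨Du, hDu, hweak, hstab⟩ := hsol.weak_and_stable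
  have hu := hsol.memSobolevLoc.1
  have hpos := hsol.pos
  refine ⟨(∑ i, C i) / ((δ - lam) * c),
    div_nonneg (Finset.sum_nonneg fun i _ => hC0 i) hdl.le, fun χ hχ hχc hχ0 hχ1 => ?_⟩
  have hpow (k : ℕ) (hk : k ≠ 0) : HasCompactSupport (fun x => χ x ^ k) :=
    hχc.comp_left (g := fun t : ℝ => t ^ k) (zero_pow hk)
  have hp1 : ∀ i, 1 ≤ p i := fun i => by linarith [hp i]
  obtain ⟨φ, hφ⟩ := exists_isTestSequence hp1 hu hpos hDu (a := 2 * β + 1) (by linarith)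
    (hχ.pow (2 * m)) (hpow (2 * m) (by omega))
  obtain ⟨ψ, hψ⟩ := exists_isTestSequence hp1 hu hpos hDu hβ (hχ.pow m) (hpow m (by omega))
  have hK1 := hpow (2 * m) (by omega)
  have hK2 := hpow m (by omega)
  simp only [partialDeriv_pow hχ] at hφ hψ
  have hf := hφ.tendsto_integral_mul hK1 hsol.locInt
  have hf' := hψ.tendsto_integral_mul_sq hK2 hsol.locInt_deriv
  have hflux := hφ.tendsto_integral_flux hK1 hDu hp
  have hquad := hψ.tendsto_integral_quadratic hK2 hDu hp
  -- `hE` and `hS` are the equation and the stability inequality for the limiting test functions.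
  have hE := tendsto_nhds_unique (tendsto_finsetSum Finset.univ fun i _ => (hflux i).2)
    (hf.2.congr fun n => (hweak (φ n) (hφ.contDiff n) (hφ.hasCompactSupport hK1 n)).symm)
  have hS := le_of_tendsto_of_tendsto' hf'.2
    (tendsto_finsetSum Finset.univ fun i _ => (hquad i).2.const_mul (p i - 1))
    (fun n => hstab (ψ n) (hψ.contDiff n) (hψ.hasCompactSupport hK2 n))
  have hTint : Integrable (fun x => (1 + u x) ^ (-κ) * χ x ^ (2 * m)) volume :=
    integrable_rpow_neg_mul hu hpos hκ0.le (hχ.continuous.pow _) hK1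
  have hDint (i : Fin N) : Integrable (fun x => |partialDeriv i χ x| ^ σ i) volume := by
    refine Continuous.integrable_of_hasCompactSupport
      ((continuous_partialDeriv hχ).abs.rpow_const fun _ => Or.inr (hσpos i).le) ?_
    refine hχc.mono' fun x hx => ?_
    by_contra h
    exact hx (by simp [partialDeriv_eq_zero_of_notMem_tsupport h, (hσpos i).ne'])
  set T := ∫ x, (1 + u x) ^ (-κ) * χ x ^ (2 * m)
  have hgradint (i : Fin N) :
      -((δ - lam) * c / N * T + C i * ∫ x, |partialDeriv i χ x| ^ σ i) ≤
        -((p i - 1) * ∫ x, |Du i x| ^ (p i - 2) * (-β * (1 + u x) ^ (-β - 1) * Du i x * χ x ^ m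
            + (1 + u x) ^ (-β) * (m * χ x ^ (m - 1) * partialDeriv i χ x)) ^ 2)
          - lam * ∫ x, |Du i x| ^ (p i - 2) * Du i x *
            (-(2 * β + 1) * (1 + u x) ^ (-(2 * β + 1) - 1) * Du i x * χ x ^ (2 * m)
              + (1 + u x) ^ (-(2 * β + 1)) *
                ((2 * m : ℕ) * χ x ^ (2 * m - 1) * partialDeriv i χ x)) := by
    have hT := hTint.const_mul ((δ - lam) * c / N)
    have hd := (hDint i).const_mul (C i)
    have hq := (hquad i).1.const_mul (p i - 1)
    have hF := (hflux i).1.const_mul lam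
    have h := integral_mono_ae (hT.add hd).neg (hq.neg.sub hF)
      (hpos.mono fun x hux => hC i (1 + u x) (χ x) (Du i x) (partialDeriv i χ x) (by linarith)
        (hχ0 x) (hχ1 x))
    rw [integral_neg', integral_add' hT hd, integral_sub' hq.neg hF, integral_neg',
      integral_const_mul, integral_const_mul, integral_const_mul, integral_const_mul] at h
    exact h
  have hreact := integral_mono_ae (hTint.const_mul (2 * (δ - lam) * c))
      (hf'.1.add (hf.1.const_mul lam)) (by
        filter_upwards [hpos, hgc] with x hux hgx
        have := reaction_terms_lower_bound (β := β) (m := m) hux hc hgx hδ hlam0 hlam.le (hχ0 x)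
        rw [← hκ, ← deriv_singularF hux] at this
        exact this)
  rw [integral_const_mul, integral_add' hf'.1 (hf.1.const_mul lam), integral_const_mul] at hreact
  have hsum := Finset.sum_le_sum fun i (_ : i ∈ Finset.univ) => hgradint i
  simp only [Finset.sum_neg_distrib, Finset.sum_add_distrib, Finset.sum_sub_distrib,
    ← Finset.mul_sum, Finset.sum_const, Finset.card_univ, Fintype.card_fin, nsmul_eq_mul] at hsum
  rw [← mul_assoc (_ / _), div_mul_cancel₀ _ hN0.ne', hE] at hsum
  have hCd : ∑ i, C i * ∫ x, |partialDeriv i χ x| ^ σ i ≤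
      (∑ i, C i) * ∑ i, ∫ x, |partialDeriv i χ x| ^ σ i := by
    rw [Finset.sum_mul]
    refine Finset.sum_le_sum fun i _ => mul_le_mul_of_nonneg_left ?_ (hC0 i)
    exact Finset.single_le_sum (f := fun i => ∫ x, |partialDeriv i χ x| ^ σ i)
      (fun j _ => integral_nonneg fun x => Real.rpow_nonneg (abs_nonneg _) _) (Finset.mem_univ i)
  rw [div_mul_eq_mul_div, le_div_iff₀ hdl]
  linarith

/-- Cutoff functions at scale `R`. -/
theorem exists_cutoff (N : ℕ) : ∃ M, 0 ≤ M ∧ ∀ R : ℝ, 1 ≤ R →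
    ∃ χ : EuclideanSpace ℝ (Fin N) → ℝ, ContDiff ℝ 1 χ ∧ HasCompactSupport χ ∧
      (∀ x, 0 ≤ χ x) ∧ (∀ x, χ x ≤ 1) ∧ (∀ x ∈ closedBall 0 1, χ x = 1) ∧
      (∀ i x, |partialDeriv i χ x| ≤ M / R) ∧
      (∀ i, ∀ x ∉ closedBall 0 (2 * R), partialDeriv i χ x = 0) := by
  let b : ContDiffBump (0 : EuclideanSpace ℝ (Fin N)) := ⟨1, 2, one_pos, one_lt_two⟩
  have hb : ContDiff ℝ 1 b := b.contDiff
  obtain ⟨M, hM0, hM⟩ := exists_bound_partialDeriv hb b.hasCompactSupport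
  refine ⟨M, hM0, fun R hR => ?_⟩
  have hR0 : 0 < R := by linarith
  have hpd (i : Fin N) (x : EuclideanSpace ℝ (Fin N)) :
      partialDeriv i (fun y => b (R⁻¹ • y)) x = R⁻¹ * partialDeriv i b (R⁻¹ • x) := by
    have h := (hb.differentiable one_ne_zero (R⁻¹ • x)).hasFDerivAt.comp x
      ((hasFDerivAt_id x).const_smul R⁻¹)
    have h' : HasFDerivAt (fun y => b (R⁻¹ • y)) _ x := h
    rw [partialDeriv, h'.fderiv]
    simp [partialDeriv]
  refine ⟨fun x => b (R⁻¹ • x), hb.comp (contDiff_const_smul _),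
    b.hasCompactSupport.comp_smul (inv_ne_zero hR0.ne'), fun x => b.nonneg, fun x => b.le_one,
    fun x hx => b.one_of_mem_closedBall ?_, fun i x => ?_, fun i x hx => ?_⟩
  · rw [mem_closedBall_zero_iff] at hx ⊢
    rw [norm_smul, norm_inv, Real.norm_of_nonneg hR0.le, inv_mul_le_iff₀ hR0]
    change ‖x‖ ≤ R * 1
    linarith
  · rw [hpd, abs_mul, abs_of_pos (inv_pos.2 hR0), div_eq_inv_mul]
    gcongr
    exact hM i _
  · rw [hpd, partialDeriv_eq_zero_of_notMem_tsupport, mul_zero]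
    rw [b.tsupport_eq]
    change R⁻¹ • x ∉ closedBall 0 2
    rw [mem_closedBall_zero_iff, not_le] at hx ⊢
    rw [norm_smul, norm_inv, Real.norm_of_nonneg hR0.le, lt_inv_mul_iff₀ hR0]
    linarith

/-- The integrand is at most `(M / R) ^ σ` on a ball of volume proportional to `(2R) ^ N`. -/
theorem integral_abs_rpow_le_of_scale {v : EuclideanSpace ℝ (Fin N) → ℝ} {M R σ : ℝ}
    (hM : 0 ≤ M) (hR : 1 ≤ R) (hσ : 0 < σ) (hv : ∀ x, |v x| ≤ M / R)
    (hv0 : ∀ x ∉ closedBall 0 (2 * R), v x = 0) :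
    ∫ x, |v x| ^ σ ≤
      M ^ σ * 2 ^ N * volume.real (ball (0 : EuclideanSpace ℝ (Fin N)) 1) * R ^ (-(σ - N)) := by
  have hR0 : 0 < R := by linarith
  rw [← setIntegral_eq_integral_of_forall_compl_eq_zero (s := closedBall 0 (2 * R))
    fun x hx => by rw [hv0 x hx, abs_zero, Real.zero_rpow hσ.ne']]
  refine (Real.le_norm_self _).trans ((norm_setIntegral_le_of_norm_le_const
    (C := (M / R) ^ σ) measure_closedBall_lt_top fun x _ => ?_).trans (le_of_eq ?_))
  · rw [Real.norm_of_nonneg (by positivity)]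
    exact Real.rpow_le_rpow (abs_nonneg _) (hv x) hσ.le
  · rw [Measure.addHaar_real_closedBall _ _ (by positivity), finrank_euclideanSpace_fin,
      Real.div_rpow hM hR0.le, neg_sub, Real.rpow_sub hR0, Real.rpow_natCast, mul_pow]
    ring

/-- A family of integral estimates for cutoff functions is incompatible with supercritical
exponents. -/
theorem not_forall_integral_le_of_exponents {u : EuclideanSpace ℝ (Fin N) → ℝ}
    (hu : LocallyIntegrable u volume) (hpos : ∀ᵐ x, 0 < u x) {κ C : ℝ} (hκ : 0 ≤ κ) (hC : 0 ≤ C)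
    {σ : Fin N → ℝ} (hσ : ∀ i, N < σ i) {k : ℕ} (hk : k ≠ 0) :
    ¬ ∀ χ : EuclideanSpace ℝ (Fin N) → ℝ, ContDiff ℝ 1 χ → HasCompactSupport χ →
      (∀ x, 0 ≤ χ x) → (∀ x, χ x ≤ 1) →
      ∫ x, (1 + u x) ^ (-κ) * χ x ^ k ≤ C * ∑ i, ∫ x, |partialDeriv i χ x| ^ σ i := by
  intro hest
  obtain ⟨M, hM, hcut⟩ := exists_cutoff N
  set B := closedBall (0 : EuclideanSpace ℝ (Fin N)) 1 with hB
  have hσ0 (i : Fin N) : 0 < σ i := (Nat.cast_nonneg N).trans_lt (hσ i)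
  have hpw : ∀ᵐ x, 0 < (1 + u x) ^ (-κ) := by
    filter_upwards [hpos] with x hx
    positivity
  have hkey (R : ℝ) (hR : 1 ≤ R) : IntegrableOn (fun x => (1 + u x) ^ (-κ)) B volume ∧
      ∫ x in B, (1 + u x) ^ (-κ) ≤ C * ∑ i, M ^ σ i * 2 ^ N *
        volume.real (ball (0 : EuclideanSpace ℝ (Fin N)) 1) * R ^ (-(σ i - N)) := by
    obtain ⟨χ, hχ, hχc, hχ0, hχ1, hχB, hχd, hχd0⟩ := hcut R hR
    have hint := integrable_rpow_neg_mul hu hpos hκ (hχ.continuous.pow k)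
      (hχc.comp_left (g := fun t : ℝ => t ^ k) (zero_pow hk))
    have heq : EqOn (fun x => (1 + u x) ^ (-κ) * χ x ^ k) (fun x => (1 + u x) ^ (-κ)) B := by
      intro x hx
      simp [hχB x hx]
    refine ⟨hint.integrableOn.congr_fun heq measurableSet_closedBall, ?_⟩
    rw [← setIntegral_congr_fun measurableSet_closedBall heq]
    refine (setIntegral_le_integral hint ?_).trans ((hest χ hχ hχc hχ0 hχ1).trans ?_)
    · filter_upwards [hpw] with x hx
      exact mul_nonneg hx.le (pow_nonneg (hχ0 x) k)
    · gcongr with i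
      exact integral_abs_rpow_le_of_scale hM hR (hσ0 i) (hχd i) (hχd0 i)
  have hlim : Tendsto (fun R : ℝ => C * ∑ i, M ^ σ i * 2 ^ N *
        volume.real (ball (0 : EuclideanSpace ℝ (Fin N)) 1) * R ^ (-(σ i - N))) atTop (𝓝 0) := by
    have h := (tendsto_finsetSum (Finset.univ : Finset (Fin N)) fun i _ =>
      (tendsto_rpow_neg_atTop (sub_pos.2 (hσ i))).const_mul (M ^ σ i * 2 ^ N *
        volume.real (ball (0 : EuclideanSpace ℝ (Fin N)) 1))).const_mul C
    simpa using h
  have hle : ∫ x in B, (1 + u x) ^ (-κ) ≤ 0 :=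
    ge_of_tendsto hlim ((eventually_ge_atTop 1).mono fun R hR => (hkey R hR).2)
  have hgt : 0 < ∫ x in B, (1 + u x) ^ (-κ) := by
    rw [integral_pos_iff_support_of_nonneg_ae (ae_restrict_of_ae (hpw.mono fun x hx => hx.le))
      (hkey 1 le_rfl).1]
    have hsupp : Function.support (fun x => (1 + u x) ^ (-κ)) =ᵐ[volume.restrict B] univ :=
      eventuallyEq_univ.2 (ae_restrict_of_ae (hpw.mono fun x hx => hx.ne'))
    rw [measure_congr hsupp, Measure.restrict_apply_univ]
    exact measure_closedBall_pos _ _ one_pos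
  exact absurd hle (not_le.2 hgt)

end AnisotropicStable

end Nonexistence

/-! ### Choice of the parameters. -/

theorem theorem3p4 (N : ℕ) (hN : 1 ≤ N)
    (p : Fin N → ℝ) (hp : ∀ i, 2 < p i) (hmono : Monotone p)
    (g : EuclideanSpace ℝ (Fin N) → ℝ) (hg : LocallyIntegrable g volume)
    (c : ℝ) (hc : 0 < c) (hgc : ∀ᵐ x, c ≤ g x)
    (hden : ∀ i, 0 < AnisotropicStable.denI p i)
    (δ γ : ℝ) (hδ : 1 ≤ δ) (hδγ : δ = γ)
    (hδAI : δ ∈ AnisotropicStable.setA hN p ∩ AnisotropicStable.setI p)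
    (u : EuclideanSpace ℝ (Fin N) → ℝ)
    (hu : AnisotropicStable.MemSobolevLoc p u) (hpos : ∀ᵐ x, 0 < u x) :
    ¬ AnisotropicStable.IsStableSolution p g (AnisotropicStable.singularF δ γ) u := by
  subst hδγ
  intro hsol
  have hN0 : (0 : ℝ) < N := by exact_mod_cast hN
  set Q : ℝ := N * (AnisotropicStable.meanExp p - 1) with hQ
  have hQsum : Q = ∑ i, (p i - 1) := by
    rw [hQ, AnisotropicStable.meanExp, Finset.sum_sub_distrib, mul_sub,
      mul_div_cancel₀ _ hN0.ne']
    simp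
  have hpQ (i : Fin N) : p i - 1 ≤ Q := by
    rw [hQsum]
    exact Finset.single_le_sum (f := fun i => p i - 1) (fun j _ => by linarith [hp j])
      (Finset.mem_univ i)
  have hQ0 : 0 < Q := by linarith [hp ⟨0, hN⟩, hpQ ⟨0, hN⟩]
  have hδ0 : 0 < δ := by linarith
  obtain ⟨hA, hI⟩ := hδAI
  rw [AnisotropicStable.setA, Set.mem_Ioi, ← hQ, div_lt_iff₀ (by norm_num)] at hA
  rw [AnisotropicStable.setI, Set.mem_iInter] at hI
  -- Since `Q = ∑ⱼ (pⱼ - 1) ≥ pᵢ - 1`, this gives `(pᵢ - 1) β² ≤ 2δβ` for all directions at once.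
  set β := 2 * δ / Q with hβ
  have hβ0 : 0 < β := by positivity
  have hβQ : β * Q = 2 * δ := div_mul_cancel₀ _ hQ0.ne'
  have hθ (i : Fin N) : p i < 2 * β + 1 := by
    have hi : p i ≤ p ⟨N - 1, by omega⟩ := hmono (Fin.le_def.2 (by have := i.2; simp; omega))
    have : p ⟨N - 1, by omega⟩ - 1 < 2 * β := by
      refine lt_of_mul_lt_mul_left ?_ hQ0.le
      linarith
    linarith
  -- Absorption needs `2δβ < lam (2β + 1)`, and `lam < δ` means `lam (2β + 1) < δ (2β + 1)`; the
  -- midpoint is taken.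
  set lam := δ * (2 * β + 1 / 2) / (2 * β + 1) with hlam
  have hlamβ : lam * (2 * β + 1) = δ * (2 * β + 1 / 2) := div_mul_cancel₀ _ (by positivity)
  have hlamlt : lam < δ := by
    rw [hlam, div_lt_iff₀ (by positivity)]
    exact mul_lt_mul_of_pos_left (by linarith) hδ0
  have hβlam (i : Fin N) : (p i - 1) * β ^ 2 < lam * (2 * β + 1) := by
    have h1 : (p i - 1) * β ^ 2 ≤ Q * β ^ 2 := mul_le_mul_of_nonneg_right (hpQ i) (sq_nonneg _)
    have h2 : Q * β ^ 2 = 2 * δ * β := by rw [← hβQ]; ring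
    rw [hlamβ]
    linarith
  set κ := δ + 1 + 2 * β with hκ
  have hκ' (i : Fin N) : 0 < p i + κ - (2 * β + 2) := by linarith [hp i]
  have hσ (i : Fin N) : (N : ℝ) < p i * κ / (p i + κ - (2 * β + 2)) := by
    rw [lt_div_iff₀ (hκ' i)]
    have h := hI i
    rw [Set.mem_Ioi, div_lt_iff₀ (hden i)] at h
    have hd : AnisotropicStable.denI p i = p i * (Q + 4) - N * Q := by
      rw [AnisotropicStable.denI, hQ]; ring
    have hn : (N : ℝ) ^ 2 * (AnisotropicStable.meanExp p - 1) * (p i - 1)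
        = N * Q * (p i - 1) := by rw [hQ]; ring
    rw [hd, hn] at h
    -- This is the condition `I` divided by `Q`, because `4δ / Q = 2β`. It is stronger than `σᵢ >
    -- N`, as `p i * κ` is larger by `p i`.
    have h2 : N * (p i + κ - (2 * β + 2)) < p i * (δ + 2 * β) := by
      refine lt_of_mul_lt_mul_left ?_ hQ0.le
      have e1 : Q * (N * (p i + κ - (2 * β + 2))) = N * Q * (p i - 1) + N * Q * δ := by
        rw [hκ]; ring
      have e2 : Q * (p i * (δ + 2 * β)) = δ * (p i * (Q + 4) - N * Q) + N * Q * δ := by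
        linear_combination 2 * p i * hβQ
      rw [e1, e2]
      linarith
    have h3 : p i * κ = p i * (δ + 2 * β) + p i := by rw [hκ]; ring
    linarith [hp i]
  obtain ⟨m, hm⟩ : ∃ m : ℕ, ∀ i, p i * κ / (p i + κ - (2 * β + 2)) ≤ m := by
    obtain ⟨b, hb⟩ := (Set.finite_range fun i => p i * κ / (p i + κ - (2 * β + 2))).bddAbove
    obtain ⟨m, hm⟩ := exists_nat_ge b
    exact ⟨m, fun i => (hb ⟨i, rfl⟩).trans hm⟩
  -- The cutoff exponent is `m + 2`, which is at least 2 and satisfies `σᵢ ≤ 2 (m + 2)`.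
  obtain ⟨C, hC, hest⟩ := hsol.exists_integral_estimate hN hp hc hgc hδ0 hβ0.le
    (by positivity : 0 ≤ lam) hlamlt (Nat.le_add_left 2 m) hβlam (fun i => by linarith [hθ i]) hκ hκ'
    (fun i => (hm i).trans (by push_cast; linarith [(Nat.cast_nonneg m : (0 : ℝ) ≤ m)]))
  exact AnisotropicStable.not_forall_integral_le_of_exponents hu.1 hpos
    (by positivity : 0 ≤ κ) hC hσ (by omega) hest
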